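/- Let $V$ be a finite set and let $G$ be a graph with node set $V$, without loops, with at most one edge between any two nodes, where each edge is undirected ($a - b$), solid directed ($a \rightarrow b$) or dashed directed ($a \dashrightarrow b$). Write $a \multimap b$ if $a \rightarrow b$, $a \dashrightarrow b$ or $a - b$ is in $G$. For $X \subseteq V$ let $Fa(X)=\{a : a \rightarrow b \text{ for some } b\in X\}$, $Mo(X)=\{a : a \dashrightarrow b \text{ for some } b\in X\}$, $Pa(X)=Fa(X)\cup Mo(X)$, $Ne(X)=\{a : a - b \text{ for some } b\in X\}$, and let $Nd(X)$ be the set of nodes $b$ for which there is no sequence $a = v_1 \multimap v_2 \multimap \cdots \multimap v_n = b$ with $a\in X$ that uses at least one directed edge. For a single node $i$ write $Fa(i)=Fa(\{i\})$, etc. A set of nodes is connected if any two of its nodes are joined by a sequence of undirected edges of $G$; the chain components of $G$ are its maximal connected sets, and $Cc(G)$ is the set of them. $G$ is a unified chain graph (UCG) if it has no semidirected cycle, i.e. no $v_1 \multimap v_2 \multimap \cdots \multimap v_n = v_1$ whose first edge is directed, and $Fa(K)\cap Mo(K)=\emptyset$ for all $K\in Cc(G)$. A route is a sequence of not necessarily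 distinct nodes in which consecutive nodes are adjacent. An (occurrence of a) node $C$ in a route is a collider node if the route, read in one of its two directions, passes through it as $A \dashrightarrow C \dashleftarrow B$, $A \dashrightarrow C - B$ or $A \dashrightarrow C \leftarrow B$. A collider section of a route is a part $C_1 - \cdots - C_n$ ($n\ge 1$) of it that the route passes through as $A \rightarrow C_1 - \cdots - C_n \leftarrow B$. For $Z\subseteq V$, a route is $Z$-open if (i) all its collider nodes are in $Z$, (ii) each of its collider sections has some node in $Z$, and (iii) all its other node occurrences (neither collider nodes nor in a collider section) are outside $Z$. For pairwise disjoint $X,Y,Z\subseteq V$, $X$ is separated from $Y$ given $Z$ in $G$ if there is no $Z$-open route between a node in $X$ and a node in $Y$. Let $p$ be a probability distribution on $\mathbb{R}^V$, and write $X\perp_p Y\mid Z$ if, under $p$, the coordinates in $X$ are conditionally independent of those in $Y$ given those in $Z$. (Set operations have equal precedence and are evaluated from left to right, unless parentheses are used to indicate a different order; singletons may be written without braces.) One says that $p$ satisfies, with respect to a UCG $G$, * the **global Markov property** if $X\perp_p Y\mid Z$ for all pairwise disjoint $X,Y,Z\subseteq V$ such that $X$ is separated from $Y$ given $Z$ in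 $G$; * the **block-recursive Markov property** if for all $K\in Cc(G)$ and $i\in K$: (B1) $i\perp_p Nd(K)\setminus K\setminus Fa(K)\setminus Mo(i)\mid Fa(K)\cup Mo(i)$, (B2) $i\perp_p Nd(K)\setminus K\setminus Fa(i)\setminus Mo(K)\mid K\setminus\{i\}\cup Fa(i)\cup Mo(K)$, (B3) $i\perp_p j\mid K\setminus\{i,j\}\cup Pa(K)$ for all $j\in K\setminus\{i\}\setminus Ne(i)$; * the **pairwise Markov property** if for all non-adjacent nodes $i,j$, with $i\in K\in Cc(G)$: (P1) $i\perp_p j\mid Nd(i)\setminus K\setminus\{j\}$ if $j\in Nd(i)\setminus K\setminus Fa(K)\setminus Mo(i)$, (P2) $i\perp_p j\mid Nd(i)\setminus\{i,j\}$ if $j\in Nd(i)\setminus\{i\}\setminus Fa(i)\setminus Mo(K)$; * the **local Markov property** if for all nodes $i$, with $i\in K\in Cc(G)$: (L1) $i\perp_p Nd(i)\setminus K\setminus Fa(K)\setminus Mo(i)\mid Fa(K)\cup Mo(i)$, (L2) $i\perp_p Nd(i)\setminus\{i\}\setminus Pa(i)\setminus Ne(i)\setminus Mo(Ne(i))\mid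 Pa(i)\cup Ne(i)\cup Mo(Ne(i))$. **Corollary.** Let $G$ be a UCG over $V$ and let $p$ be a Gaussian distribution on $\mathbb{R}^V$ with positive definite covariance matrix. Then the global, block-recursive, local and pairwise Markov properties of $p$ with respect to $G$ are all equivalent. -/

import Mathlib

open MeasureTheory ProbabilityTheory

/-- A graph with undirected edges (`line`), solid directed edges (`solid a b` is
`a → b`) and dashed directed edges (`dashed a b` is the dashed arrow from `a` to `b`), having no
loops and at most one edge between any two nodes. -/
structure MixedGraph (V : Type*) where
  line : V → V → Prop
  solid : V → V → Prop
  dashed : V → V → Prop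
  line_symm : ∀ a b, line a b → line b a
  line_irrefl : ∀ a, ¬ line a a
  not_line_solid : ∀ a b, ¬ (line a b ∧ solid a b)
  not_line_dashed : ∀ a b, ¬ (line a b ∧ dashed a b)
  not_solid_solid : ∀ a b, ¬ (solid a b ∧ solid b a)
  not_dashed_dashed : ∀ a b, ¬ (dashed a b ∧ dashed b a)
  not_solid_dashed : ∀ a b, ¬ (solid a b ∧ dashed a b)
  not_solid_dashed_rev : ∀ a b, ¬ (solid a b ∧ dashed b a)

namespace MixedGraph

variable {V : Type*} (G : MixedGraph V)

/-- There is a directed edge (solid or dashed) from `a` to `b`. -/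
def Arrow (a b : V) : Prop := G.solid a b ∨ G.dashed a b

/-- There is an edge `a → b`, a dashed edge from `a` to `b`, or an edge `a - b`. -/
def Step (a b : V) : Prop := G.Arrow a b ∨ G.line a b

/-- The fathers of a set of nodes. -/
def Fa (X : Set V) : Set V := {a | ∃ b ∈ X, G.solid a b}

/-- The mothers of a set of nodes. -/
def Mo (X : Set V) : Set V := {a | ∃ b ∈ X, G.dashed a b}

/-- The parents of a set of nodes. -/
def Pa (X : Set V) : Set V := {a | ∃ b ∈ X, G.solid a b ∨ G.dashed a b}

/-- The neighbors of a set of nodes. -/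
def Ne (X : Set V) : Set V := {a | ∃ b ∈ X, G.line a b}

/-- The non-descendants of `X`: the nodes `b` such that no route `a ⊸ ⋯ ⊸ b` with `a ∈ X`, all of
whose edges are undirected or point towards `b`, contains a directed edge. -/
def Nd (X : Set V) : Set V :=
  {b | ¬ ∃ a ∈ X, ∃ c d, Relation.ReflTransGen G.Step a c ∧ G.Arrow c d ∧
    Relation.ReflTransGen G.Step d b}

/-- No semidirected cycle: no cycle that starts with a directed edge and continues along edges
that are undirected or point forwards. -/
def IsChainGraph : Prop := ∀ a b, G.Arrow a b → ¬ Relation.ReflTransGen G.Step b a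

/-- Every two nodes of `S` are joined by an undirected route. -/
def IsConnectedSet (S : Set V) : Prop :=
  ∀ a ∈ S, ∀ b ∈ S, Relation.ReflTransGen G.line a b

/-- The chain components: the maximal connected sets. -/
def Cc : Set (Set V) := {K | Maximal G.IsConnectedSet K}

/-- Unified chain graphs. -/
structure IsUCG : Prop where
  isChainGraph : G.IsChainGraph
  disjoint_Fa_Mo : ∀ K ∈ G.Cc, Disjoint (G.Fa K) (G.Mo K)

/-- The underlying simple graph. Its walks are the routes of `G`: sequences of not necessarily
distinct nodes in which consecutive nodes are adjacent (the edge between them is unique). -/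
def skeleton : SimpleGraph V where
  Adj a b := G.Step a b ∨ G.Step b a
  symm := ⟨fun _ _ h => h.symm⟩
  loopless := ⟨fun a h => by
    have h' : G.Step a a := h.elim id id
    rcases h' with (h | h) | h
    · exact G.not_solid_solid a a ⟨h, h⟩
    · exact G.not_dashed_dashed a a ⟨h, h⟩
    · exact G.line_irrefl a h⟩

variable {G} in
/-- The occurrence at position `k` of the route `ρ` is a collider node: it is an intermediate
occurrence `C` in which `ρ`, read in one of the two directions, has a dashed edge from `A` to `C`
followed by a dashed edge from `B` to `C`, an edge `C - B`, or an edge `B → C`. -/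
def IsColliderNode {a b : V} (ρ : G.skeleton.Walk a b) (k : ℕ) : Prop :=
  0 < k ∧ k < ρ.length ∧
    ((G.dashed (ρ.getVert (k - 1)) (ρ.getVert k) ∧
        (G.dashed (ρ.getVert (k + 1)) (ρ.getVert k) ∨ G.line (ρ.getVert k) (ρ.getVert (k + 1)) ∨
          G.solid (ρ.getVert (k + 1)) (ρ.getVert k))) ∨
      (G.dashed (ρ.getVert (k + 1)) (ρ.getVert k) ∧
        (G.dashed (ρ.getVert (k - 1)) (ρ.getVert k) ∨ G.line (ρ.getVert k) (ρ.getVert (k - 1)) ∨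
          G.solid (ρ.getVert (k - 1)) (ρ.getVert k))))

variable {G} in
/-- The positions `s, …, t` of the route `ρ` form a collider section
`A → C₁ - ⋯ - Cₙ ← B`, with `n ≥ 1` (it is a maximal undirected subroute, as it is flanked by
directed edges). -/
def IsColliderSection {a b : V} (ρ : G.skeleton.Walk a b) (s t : ℕ) : Prop :=
  0 < s ∧ s ≤ t ∧ t < ρ.length ∧
    G.solid (ρ.getVert (s - 1)) (ρ.getVert s) ∧
    (∀ k, s ≤ k → k < t → G.line (ρ.getVert k) (ρ.getVert (k + 1))) ∧
    G.solid (ρ.getVert (t + 1)) (ρ.getVert t)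

variable {G} in
/-- The route `ρ` is `Z`-open. -/
structure IsOpenRoute (Z : Set V) {a b : V} (ρ : G.skeleton.Walk a b) : Prop where
  collider_node : ∀ k, IsColliderNode ρ k → ρ.getVert k ∈ Z
  collider_section : ∀ s t, IsColliderSection ρ s t → ∃ k, s ≤ k ∧ k ≤ t ∧ ρ.getVert k ∈ Z
  other : ∀ k ≤ ρ.length, ¬ IsColliderNode ρ k →
    (¬ ∃ s t, IsColliderSection ρ s t ∧ s ≤ k ∧ k ≤ t) → ρ.getVert k ∉ Z

/-- `X` is separated from `Y` given `Z` in `G`. -/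
def Separated (X Y Z : Set V) : Prop :=
  ∀ a ∈ X, ∀ b ∈ Y, ∀ ρ : G.skeleton.Walk a b, ¬ IsOpenRoute Z ρ

end MixedGraph

/-- The coordinates indexed by `X` and those indexed by `Y` are conditionally independent given
those indexed by `Z`, under the distribution `p` of a random vector indexed by `V`. -/
def CondIndepCoords {V : Type*} [Fintype V] (p : Measure (V → ℝ)) [IsFiniteMeasure p]
    (X Y Z : Set V) : Prop :=
  CondIndepFun (MeasurableSpace.comap (fun (x : V → ℝ) (v : Z) => x v) inferInstance)
    (Measurable.comap_le (measurable_pi_lambda _ fun _ => measurable_pi_apply _))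
    (fun (x : V → ℝ) (v : X) => x v) (fun (x : V → ℝ) (v : Y) => x v) p

/-- The covariance matrix of a distribution of a random vector indexed by `V`. -/
noncomputable def covMatrix {V : Type*} (p : Measure (V → ℝ)) : Matrix V V ℝ :=
  Matrix.of fun i j => covariance (fun x => x i) (fun x => x j) p

namespace MixedGraph

variable {V : Type*} [Fintype V] (G : MixedGraph V) (p : Measure (V → ℝ)) [IsFiniteMeasure p]

/-- The global Markov property. -/
def GlobalMarkov : Prop :=
  ∀ X Y Z : Set V, Disjoint X Y → Disjoint X Z → Disjoint Y Z →
    G.Separated X Y Z → CondIndepCoords p X Y Z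

/-- The block-recursive Markov property (B1)-(B3). -/
def BlockRecursiveMarkov : Prop :=
  ∀ K ∈ G.Cc, ∀ i ∈ K,
    CondIndepCoords p {i} (((G.Nd K \ K) \ G.Fa K) \ G.Mo {i}) (G.Fa K ∪ G.Mo {i}) ∧
    CondIndepCoords p {i} (((G.Nd K \ K) \ G.Fa {i}) \ G.Mo K)
      (((K \ {i}) ∪ G.Fa {i}) ∪ G.Mo K) ∧
    ∀ j ∈ (K \ {i}) \ G.Ne {i}, CondIndepCoords p {i} {j} ((K \ {i, j}) ∪ G.Pa K)

/-- The pairwise Markov property (P1)-(P2). -/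
def PairwiseMarkov : Prop :=
  ∀ K ∈ G.Cc, ∀ i ∈ K, ∀ j, ¬ G.skeleton.Adj i j →
    (j ∈ ((G.Nd {i} \ K) \ G.Fa K) \ G.Mo {i} →
      CondIndepCoords p {i} {j} ((G.Nd {i} \ K) \ {j})) ∧
    (j ∈ ((G.Nd {i} \ {i}) \ G.Fa {i}) \ G.Mo K →
      CondIndepCoords p {i} {j} (G.Nd {i} \ {i, j}))

/-- The local Markov property (L1)-(L2). -/
def LocalMarkov : Prop :=
  ∀ K ∈ G.Cc, ∀ i ∈ K,
    CondIndepCoords p {i} (((G.Nd {i} \ K) \ G.Fa K) \ G.Mo {i}) (G.Fa K ∪ G.Mo {i}) ∧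
    CondIndepCoords p {i}
      ((((G.Nd {i} \ {i}) \ G.Pa {i}) \ G.Ne {i}) \ G.Mo (G.Ne {i}))
      ((G.Pa {i} ∪ G.Ne {i}) ∪ G.Mo (G.Ne {i}))

end MixedGraph

/-! For a Gaussian vector with positive definite covariance matrix `A`, independence of `i` from `Y`
given `T` means that the regression of `i` on `Y ∪ T` has no coefficients on `Y`
(`condIndepCoords_singleton_iff`). Two regressions of each node `i` of a chain component `K`
suffice: on the non-descendants outside `K`, with residual vector `g i`, and on all other
non-descendants, with residual vector `h i`. They are tied together by `h i = ∑ k ∈ K, h i k • g k`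
(`IsRegression.h_eq_sum`). The block-recursive, pairwise and local properties all become the same
list of vanishing coefficients, `RegressionZeros`.

To pass from this list to the global property, let the `g i` be the rows of `U = 1 - B - F`, where
`B` lives on dashed edges and `F` on the fathers of components. The zeros give `A⁻¹ = Uᵀ * W * U`
with `W` positive definite and supported on the diagonal and the undirected edges, and `W * F`
supported on solid edges (`exists_factorization`). Let `γ` be the residual vector of `a` given `Z`;
its covariances are `c = A *ᵥ γ`. If no open route joins `a` to `b`, call a node live when an open
route from `a` can involve it; `b` is not live. Liveness is compatible with the edges along which
`c` is not already known to vanish. Therefore the restriction of `c` to the relevant nodes that are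
not live (relevant: in `Z ∪ {a, b}`, or leading there along suitable arrows) yields a vector at
which the quadratic form of `W` is zero, and this forces `c b = 0` (`Factorization.mulVec_eq_zero`).
The compatibility is proved by concatenating open routes (`OpenVia.join`, `Relevant.excursion`).

The circle is closed by two separations, `IsChainGraph.separated_Pred` and
`IsChainGraph.separated_Nd`, which show that the global property implies the pairwise one for any
distribution. -/

open scoped Matrix

/-! ### Gaussian residuals and conditional independence -/

/-- `g` is the coefficient vector of the residual of the coordinate `a` after linear regression on
the coordinates in `S`, for a random vector with covariance matrix `A`. -/
structure IsResid {V : Type*} [Fintype V] (A : Matrix V V ℝ) (S : Set V) (a : V) (g : V → ℝ) :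
    Prop where
  self : g a = 1
  zero : ∀ j, j ∉ S → j ≠ a → g j = 0
  orth : ∀ s ∈ S, (A *ᵥ g) s = 0

section Gaussian

variable {V : Type*} [Fintype V] (p : Measure (V → ℝ)) [IsGaussian p]

lemma memLp_two_coord (i : V) : MemLp (fun x : V → ℝ => x i) 2 p :=
  HasGaussianLaw.memLp_two
    (IsGaussian.hasGaussianLaw_id.map (ContinuousLinearMap.proj (R := ℝ) (φ := fun _ : V => ℝ) i))

lemma memLp_two_dotProduct (g : V → ℝ) : MemLp (fun x : V → ℝ => g ⬝ᵥ x) 2 p := by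
  simp only [dotProduct]
  exact memLp_finsetSum _ fun i _ => (memLp_two_coord p i).const_mul (g i)

lemma covariance_dotProduct_coord (g : V → ℝ) (b : V) :
    covariance (fun x => g ⬝ᵥ x) (fun x => x b) p = (covMatrix p *ᵥ g) b := by
  simp only [dotProduct, Matrix.mulVec, covMatrix, Matrix.of_apply]
  rw [covariance_fun_sum_left fun i => (memLp_two_coord p i).const_mul (g i)]
  · refine Finset.sum_congr rfl fun i _ => ?_
    rw [covariance_const_mul_left, covariance_comm, mul_comm]
  · exact memLp_two_coord p b

/-- Both families are linear images of one Gaussian vector, hence jointly Gaussian, so zero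
covariances give independence. -/
lemma indepFun_dotProduct_coords {X : Set V} (S : Set V) (g : X → V → ℝ)
    (h : ∀ a, ∀ s ∈ S, (covMatrix p *ᵥ g a) s = 0) :
    IndepFun (fun (x : V → ℝ) a => g a ⬝ᵥ x) (fun (x : V → ℝ) (s : S) => x s) p := by
  refine HasGaussianLaw.indepFun_of_covariance_eval ?_ fun a s => ?_
  · have := Fintype.ofFinite X
    have := Fintype.ofFinite S
    let L₁ : (V → ℝ) →L[ℝ] (X → ℝ) := ContinuousLinearMap.pi fun a =>
      ∑ i, g a i • ContinuousLinearMap.proj (R := ℝ) (φ := fun _ : V => ℝ) i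
    let L₂ : (V → ℝ) →L[ℝ] (S → ℝ) := ContinuousLinearMap.pi fun s =>
      ContinuousLinearMap.proj (R := ℝ) (φ := fun _ : V => ℝ) (s : V)
    have h := (IsGaussian.hasGaussianLaw_id (μ := p)).map (L₁.prod L₂)
    have e : (fun x : V → ℝ => (fun a => g a ⬝ᵥ x, fun s : S => x s)) = L₁.prod L₂ ∘ id := by
      ext x a <;> simp [L₁, L₂, dotProduct]
    rw [e]
    exact h
  · rw [covariance_dotProduct_coord]
    exact h a s s.2

end Gaussian

/-- If `R` is independent of `W`, then the conditional distribution of `φ (W, R)` given `W` is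
obtained by freezing `W`. -/
lemma condDistrib_of_indepFun {Ω β γ δ : Type*} {mΩ : MeasurableSpace Ω} {mβ : MeasurableSpace β}
    {mγ : MeasurableSpace γ} {mδ : MeasurableSpace δ} [StandardBorelSpace δ] [Nonempty δ]
    {μ : Measure Ω} [IsProbabilityMeasure μ] {W : Ω → β} {R : Ω → γ} (hW : Measurable W)
    (hR : Measurable R) (hind : IndepFun W R μ) {φ : β × γ → δ} (hφ : Measurable φ) :
    condDistrib (fun ω => φ (W ω, R ω)) W μ =ᵐ[μ.map W]
      (Kernel.id ×ₖ Kernel.const β (μ.map R)).map φ := by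
  have : IsProbabilityMeasure (μ.map R) := Measure.isProbabilityMeasure_map hR.aemeasurable
  have : IsProbabilityMeasure (μ.map W) := Measure.isProbabilityMeasure_map hW.aemeasurable
  have hm : Measurable fun ω => φ (W ω, R ω) := by fun_prop
  refine condDistrib_ae_eq_of_measure_eq_compProd W hm.aemeasurable ?_
  have h1 : μ.map (fun ω => (W ω, φ (W ω, R ω))) =
      ((μ.map W).prod (μ.map R)).map (fun q => (q.1, φ q)) := by
    rw [← (indepFun_iff_map_prod_eq_prod_map_map hW.aemeasurable hR.aemeasurable).1 hind,
      Measure.map_map (by fun_prop) (by fun_prop)]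
    rfl
  rw [h1]
  ext s hs
  rw [Measure.map_apply (by fun_prop) hs, Measure.compProd_apply hs,
    Measure.prod_apply ((by fun_prop : Measurable fun q : β × γ => (q.1, φ q)) hs)]
  refine lintegral_congr fun w => ?_
  have hs' : MeasurableSet (Prod.mk w ⁻¹' s) := measurable_prodMk_left hs
  rw [Kernel.map_apply' _ hφ _ hs', Kernel.prod_apply, Kernel.id_apply, Kernel.const_apply,
    Measure.prod_apply (hφ hs'), lintegral_dirac' _ (measurable_measure_prodMk_left (hφ hs'))]
  rfl

section CondIndep

variable {V : Type*} [Fintype V] {p : Measure (V → ℝ)} [IsGaussian p]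

open Classical in
lemma IsResid.dotProduct_eq {A : Matrix V V ℝ} {S : Set V} {a : V} {g : V → ℝ}
    (hg : IsResid A S a g) (ha : a ∉ S) (x : V → ℝ) :
    g ⬝ᵥ x = x a + ∑ j, if j ∈ S then g j * x j else 0 := by
  have : x a = ∑ j, if j = a then x j else 0 := by simp
  rw [this, ← Finset.sum_add_distrib, dotProduct]
  refine Finset.sum_congr rfl fun j _ => ?_
  by_cases hj : j = a
  · subst hj
    simp [ha, hg.self]
  · by_cases hS : j ∈ S
    · simp [hj, hS]
    · simp [hj, hS, hg.zero j hS hj]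

/-- A coordinate in `X` is its residual up to a linear function of the coordinates in `Z`. The
residuals are independent of the coordinates in `Z` and `Y` jointly, so the conditional law of the
`X`-coordinates given both depends on those in `Z` only. -/
lemma condIndepCoords_of_resid {X Y Z : Set V} (hXZ : Disjoint X Z)
    (h : ∀ a ∈ X, ∃ g, IsResid (covMatrix p) Z a g ∧ ∀ b ∈ Y, (covMatrix p *ᵥ g) b = 0) :
    CondIndepCoords p X Y Z := by
  classical
  choose! g hg hgY using h
  let k : (V → ℝ) → (Z → ℝ) := fun x v => x v
  let r : (V → ℝ) → (X → ℝ) := fun x a => g a ⬝ᵥ x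
  let w : (V → ℝ) → (Z → ℝ) × (Y → ℝ) := fun x => (k x, fun v => x v)
  have hk : Measurable k := measurable_pi_lambda _ fun _ => measurable_pi_apply _
  have hr : Measurable r := by
    refine measurable_pi_lambda _ fun a => ?_
    simp only [r, dotProduct]
    fun_prop
  have hY : Measurable fun (x : V → ℝ) (v : Y) => x v :=
    measurable_pi_lambda _ fun _ => measurable_pi_apply _
  have hw : Measurable w := hk.prodMk hY
  let φ : (Z → ℝ) × (X → ℝ) → (X → ℝ) := fun q a =>
    q.2 a - ∑ j, if hj : j ∈ Z then g a j * q.1 ⟨j, hj⟩ else 0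
  have hφ : Measurable φ := by
    refine measurable_pi_lambda _ fun a => Measurable.sub (by fun_prop) ?_
    refine Finset.measurable_sum _ fun j _ => ?_
    split_ifs <;> fun_prop
  have hX : (fun (x : V → ℝ) (v : X) => x v) = fun x => φ (k x, r x) := by
    ext x a
    have := (hg a a.2).dotProduct_eq (Set.disjoint_left.1 hXZ a.2) x
    simp only [φ, r, k, this]
    simp
  have hind : IndepFun w r p := by
    have h1 := indepFun_dotProduct_coords p (Z ∪ Y) (fun a : X => g a) (by
      rintro a s (hs | hs)
      · exact (hg a a.2).orth s hs
      · exact hgY a a.2 s hs)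
    have h2 := h1.symm.comp (φ := fun y : (Z ∪ Y : Set V) → ℝ =>
      ((fun z : Z => y ⟨z, Or.inl z.2⟩, fun z : Y => y ⟨z, Or.inr z.2⟩) : (Z → ℝ) × (Y → ℝ)))
      (ψ := id) (by fun_prop) measurable_id
    exact h2
  have hind' : IndepFun k r p := hind.comp measurable_fst measurable_id
  have main : CondIndepFun (MeasurableSpace.comap k inferInstance) hk.comap_le
      (fun (x : V → ℝ) (v : Y) => x v) (fun x => φ (k x, r x)) p := by
    rw [condIndepFun_iff_condDistrib_prod_ae_eq_prodMkRight (by fun_prop) hY hk]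
    have e1 := condDistrib_of_indepFun hw hr hind
      (φ := fun q : ((Z → ℝ) × (Y → ℝ)) × (X → ℝ) => φ (q.1.1, q.2)) (by fun_prop)
    have e2 := condDistrib_of_indepFun hk hr hind' hφ
    have hmap : p.map k = (p.map w).map Prod.fst := by
      rw [Measure.map_map measurable_fst hw]
      rfl
    rw [hmap] at e2
    have e3 := ae_of_ae_map measurable_fst.aemeasurable e2
    filter_upwards [e1, e3] with q h1 h3
    refine h1.trans ?_
    rw [Kernel.prodMkRight_apply, h3]
    rw [Kernel.map_apply _ hφ, Kernel.map_apply _ (by fun_prop), Kernel.prod_apply,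
      Kernel.prod_apply, Kernel.id_apply, Kernel.const_apply, Kernel.id_apply, Kernel.const_apply]
    have : IsProbabilityMeasure (p.map r) := Measure.isProbabilityMeasure_map hr.aemeasurable
    rw [Measure.dirac_prod, Measure.dirac_prod, Measure.map_map (by fun_prop) (by fun_prop),
      Measure.map_map hφ (by fun_prop)]
    rfl
  unfold CondIndepCoords
  rw [hX]
  exact main.symm

/-- Write the residual as `r = x a + l` with `l` a function of the `Z`-coordinates. Conditional
independence gives `E[x a | Z, x b] = E[x a | Z] = E r - l`. Multiplying by `x b` and integrating
yields `E[r * x b] = E r * E x b`. -/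
lemma CondIndepCoords.mulVec_eq_zero {X Y Z : Set V} (hXZ : Disjoint X Z)
    (h : CondIndepCoords p X Y Z) {a b : V} (ha : a ∈ X) (hb : b ∈ Y) {g : V → ℝ}
    (hg : IsResid (covMatrix p) Z a g) : (covMatrix p *ᵥ g) b = 0 := by
  classical
  let k : (V → ℝ) → (Z → ℝ) := fun x v => x v
  have hk : Measurable k := measurable_pi_lambda _ fun _ => measurable_pi_apply _
  have haZ : a ∉ Z := Set.disjoint_left.1 hXZ ha
  have hab : CondIndepFun (MeasurableSpace.comap k inferInstance) hk.comap_le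
      (fun x : V → ℝ => x b) (fun x : V → ℝ => x a) p :=
    (CondIndepFun.comp h (measurable_pi_apply (⟨a, ha⟩ : X))
      (measurable_pi_apply (⟨b, hb⟩ : Y))).symm
  have ma : Measurable fun x : V → ℝ => x a := measurable_pi_apply a
  have mb : Measurable fun x : V → ℝ => x b := measurable_pi_apply b
  rw [condIndepFun_iff_condDistrib_prod_ae_eq_prodMkRight ma mb hk] at hab
  have ia : Integrable (fun x : V → ℝ => x a) p := (memLp_two_coord p a).integrable one_le_two
  have ib : Integrable (fun x : V → ℝ => x b) p := (memLp_two_coord p b).integrable one_le_two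
  have mw : Measurable fun x : V → ℝ => (k x, x b) := hk.prodMk mb
  let r : (V → ℝ) → ℝ := fun x => g ⬝ᵥ x
  let l : (V → ℝ) → ℝ := fun x => ∑ j, if j ∈ Z then g j * x j else 0
  have hr : ∀ x, r x = x a + l x := hg.dotProduct_eq haZ
  have ir : Integrable r p := (memLp_two_dotProduct p g).integrable one_le_two
  have hl2 : MemLp l 2 p := by
    have : l = fun x => r x - x a := by
      ext x
      rw [hr]
      ring
    rw [this]
    exact (memLp_two_dotProduct p g).sub (memLp_two_coord p a)
  have il : Integrable l p := hl2.integrable one_le_two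
  have c1 := condExp_ae_eq_integral_condDistrib' mw ia
  have c2 := condExp_ae_eq_integral_condDistrib' hk ia
  have c3 : ∀ᵐ x ∂p, (∫ y, y ∂condDistrib (fun x : V → ℝ => x a) (fun x => (k x, x b)) p (k x, x b))
      = ∫ y, y ∂condDistrib (fun x : V → ℝ => x a) k p (k x) := by
    filter_upwards [ae_of_ae_map mw.aemeasurable hab] with x hx
    rw [hx, Kernel.prodMkRight_apply]
  have hlm : StronglyMeasurable[MeasurableSpace.comap k inferInstance] l := by
    have : l = (fun y : Z → ℝ => ∑ j, if hj : j ∈ Z then g j * y ⟨j, hj⟩ else 0) ∘ k := by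
      ext x
      simp [l, k]
    rw [this]
    refine Measurable.stronglyMeasurable (Measurable.comp ?_ (comap_measurable k))
    refine Finset.measurable_sum _ fun j _ => ?_
    split_ifs <;> fun_prop
  have hind : IndepFun r k p := by
    have h1 := indepFun_dotProduct_coords p Z (fun _ : ({a} : Set V) => g) fun _ => hg.orth
    exact h1.comp (φ := fun y : ({a} : Set V) → ℝ => y ⟨a, rfl⟩) (ψ := id) (by fun_prop)
      measurable_id
  have mr : Measurable r := by
    simp only [r, dotProduct]
    fun_prop
  have c4 : p[fun x : V → ℝ => x a | MeasurableSpace.comap k inferInstance] =ᵐ[p]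
      fun x => p[r] - l x := by
    have e1 : p[r | MeasurableSpace.comap k inferInstance] =ᵐ[p] fun _ => p[r] :=
      condExp_indep_eq mr.comap_le hk.comap_le (comap_measurable r).stronglyMeasurable hind
    have e2 := condExp_sub ir il (MeasurableSpace.comap k inferInstance)
    have e3 : p[l | MeasurableSpace.comap k inferInstance] = l :=
      condExp_of_stronglyMeasurable hk.comap_le hlm il
    have e4 : (fun x : V → ℝ => x a) = r - l := by
      ext x
      simp [hr]
    rw [e4]
    filter_upwards [e1, e2] with x h1 h2
    rw [h2, Pi.sub_apply, h1, e3]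
  have hmul : Integrable ((fun x : V → ℝ => x a) * fun x => x b) p :=
    (memLp_two_coord p a).integrable_mul (memLp_two_coord p b)
  have c5 : ∫ x, x a * x b ∂p = ∫ x, (p[r] - l x) * x b ∂p := by
    have hbm : StronglyMeasurable[MeasurableSpace.comap (fun x => (k x, x b)) inferInstance]
        (fun x : V → ℝ => x b) :=
      (measurable_snd.comp (comap_measurable (fun x : V → ℝ => (k x, x b)))).stronglyMeasurable
    have e1 := condExp_mul_of_stronglyMeasurable_right hbm hmul ia
    calc ∫ x, x a * x b ∂p
        = ∫ x, (p[(fun x : V → ℝ => x a) * fun x => x b |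
            MeasurableSpace.comap (fun x => (k x, x b)) inferInstance]) x ∂p :=
          (integral_condExp mw.comap_le).symm
      _ = ∫ x, (p[r] - l x) * x b ∂p := by
          refine integral_congr_ae ?_
          filter_upwards [e1, c1, c2, c3, c4] with x h1 h2 h3 h4 h5
          rw [h1, Pi.mul_apply, h2, h4, ← h3, h5]
  rw [← covariance_dotProduct_coord, covariance_eq_sub (memLp_two_dotProduct p g)
    (memLp_two_coord p b)]
  have hlb : Integrable (fun x : V → ℝ => l x * x b) p := hl2.integrable_mul (memLp_two_coord p b)
  have e6 : ∫ x, (p[r] - l x) * x b ∂p = p[r] * ∫ x, x b ∂p - ∫ x, l x * x b ∂p := by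
    simp only [sub_mul]
    rw [integral_sub (ib.const_mul _) hlb, integral_const_mul]
  have e7 : ∫ x, r x * x b ∂p = ∫ x, x a * x b ∂p + ∫ x, l x * x b ∂p := by
    rw [← integral_add (f := fun x : V → ℝ => x a * x b) hmul hlb]
    refine integral_congr_ae (Filter.Eventually.of_forall fun x => ?_)
    simp only [hr]
    ring
  have e8 : ∫ x, r x * x b ∂p = p[r] * ∫ x, x b ∂p := by
    rw [e7, c5, e6]
    ring
  simp only [Pi.mul_apply]
  exact sub_eq_zero.2 e8

end CondIndep

/-! ### Chain components and strict descendants -/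

namespace MixedGraph

variable {V : Type*} {G : MixedGraph V}

/-- `b` is a strict descendant of `a`. -/
def StrictDesc (G : MixedGraph V) (a b : V) : Prop :=
  ∃ c d, Relation.ReflTransGen G.Step a c ∧ G.Arrow c d ∧ Relation.ReflTransGen G.Step d b

/-- `a` and `b` are joined by an undirected route. -/
def Linked (G : MixedGraph V) (a b : V) : Prop := Relation.ReflTransGen G.line a b

/-- The chain component of a node. -/
def comp (G : MixedGraph V) (i : V) : Set V := {j | G.Linked i j}

lemma Linked.refl (i : V) : G.Linked i i := Relation.ReflTransGen.refl

lemma Linked.symm {i j : V} (h : G.Linked i j) : G.Linked j i := by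
  induction h with
  | refl => exact Linked.refl _
  | tail _ h ih => exact Relation.ReflTransGen.head (G.line_symm _ _ h) ih

lemma Linked.trans {i j k : V} (h : G.Linked i j) (h' : G.Linked j k) : G.Linked i k :=
  Relation.ReflTransGen.trans h h'

lemma linked_of_line {i j : V} (h : G.line i j) : G.Linked i j := Relation.ReflTransGen.single h

lemma Linked.steps {i j : V} (h : G.Linked i j) : Relation.ReflTransGen G.Step i j :=
  Relation.ReflTransGen.mono (fun _ _ h => Or.inr h) _ _ h

lemma mem_comp_self (i : V) : i ∈ G.comp i := Linked.refl i

lemma mem_comp {i j : V} : j ∈ G.comp i ↔ G.Linked i j := Iff.rfl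

lemma Linked.comp_eq {i j : V} (h : G.Linked i j) : G.comp i = G.comp j :=
  Set.ext fun _ => ⟨fun h' => h.symm.trans h', fun h' => h.trans h'⟩

lemma isConnectedSet_comp (i : V) : G.IsConnectedSet (G.comp i) :=
  fun _ ha _ hb => (Linked.symm ha).trans hb

lemma eq_comp_of_mem_Cc {K : Set V} (hK : K ∈ G.Cc) {i : V} (hi : i ∈ K) : K = G.comp i := by
  have h : K ⊆ G.comp i := fun j hj => hK.1 i hi j hj
  exact h.antisymm (hK.2 (isConnectedSet_comp i) h)

lemma comp_mem_Cc (i : V) : G.comp i ∈ G.Cc := by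
  refine ⟨isConnectedSet_comp i, fun S hS hi j hj => ?_⟩
  exact hS i (hi (mem_comp_self i)) j hj

lemma forall_mem_Cc {P : Set V → V → Prop} :
    (∀ K ∈ G.Cc, ∀ i ∈ K, P K i) ↔ ∀ i, P (G.comp i) i := by
  refine ⟨fun h i => h _ (comp_mem_Cc i) i (mem_comp_self i), fun h K hK i hi => ?_⟩
  rw [eq_comp_of_mem_Cc hK hi]
  exact h i

lemma StrictDesc.of_arrow {i j : V} (h : G.Arrow i j) : G.StrictDesc i j :=
  ⟨i, j, .refl, h, .refl⟩

lemma StrictDesc.steps {i j : V} (h : G.StrictDesc i j) : Relation.ReflTransGen G.Step i j := by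
  obtain ⟨c, d, h1, h2, h3⟩ := h
  exact (h1.tail (Or.inl h2)).trans h3

lemma StrictDesc.trans_steps {i j k : V} (h : G.StrictDesc i j)
    (h' : Relation.ReflTransGen G.Step j k) : G.StrictDesc i k := by
  obtain ⟨c, d, h1, h2, h3⟩ := h
  exact ⟨c, d, h1, h2, h3.trans h'⟩

lemma StrictDesc.steps_trans {i j k : V} (h' : Relation.ReflTransGen G.Step i j)
    (h : G.StrictDesc j k) : G.StrictDesc i k := by
  obtain ⟨c, d, h1, h2, h3⟩ := h
  exact ⟨c, d, h'.trans h1, h2, h3⟩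

lemma mem_Nd_singleton {i j : V} : j ∈ G.Nd {i} ↔ ¬ G.StrictDesc i j := by
  simp [Nd, StrictDesc]

lemma Nd_comp (i : V) : G.Nd (G.comp i) = G.Nd {i} := by
  ext j
  rw [mem_Nd_singleton]
  refine not_congr ⟨?_, fun h => ⟨i, mem_comp_self i, h⟩⟩
  rintro ⟨k, hk, h⟩
  exact StrictDesc.steps_trans (Linked.steps hk) h

lemma IsChainGraph.irrefl (hG : G.IsChainGraph) (i : V) : ¬ G.StrictDesc i i := by
  rintro ⟨c, d, h1, h2, h3⟩
  exact hG c d h2 (h3.trans h1)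

lemma IsChainGraph.wellFounded [Finite V] (hG : G.IsChainGraph) : WellFounded G.StrictDesc := by
  have : IsTrans V G.StrictDesc := ⟨fun _ _ _ h h' => h.trans_steps h'.steps⟩
  have : Std.Irrefl G.StrictDesc := ⟨hG.irrefl⟩
  exact Finite.wellFounded_of_trans_of_irrefl _

lemma IsChainGraph.wellFounded_swap [Finite V] (hG : G.IsChainGraph) :
    WellFounded (Function.swap G.StrictDesc) := by
  have : IsTrans V (Function.swap G.StrictDesc) := ⟨fun _ _ _ h h' => h'.trans_steps h.steps⟩
  have : Std.Irrefl (Function.swap G.StrictDesc) := ⟨hG.irrefl⟩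
  exact Finite.wellFounded_of_trans_of_irrefl _

/-- The nodes outside the chain component of `i` that are not descendants of `i`. -/
def Pred (G : MixedGraph V) (i : V) : Set V := G.Nd {i} \ G.comp i

lemma Linked.Pred_eq {i j : V} (h : G.Linked i j) : G.Pred i = G.Pred j := by
  rw [Pred, Pred, ← Nd_comp i, ← Nd_comp j, h.comp_eq]

lemma mem_Pred {i j : V} : j ∈ G.Pred i ↔ ¬ G.StrictDesc i j ∧ ¬ G.Linked i j := by
  rw [Pred, Set.mem_sdiff, mem_Nd_singleton, mem_comp]

lemma IsChainGraph.mem_Pred_of_arrow (hG : G.IsChainGraph) {i j : V} (h : G.Arrow j i) :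
    j ∈ G.Pred i := by
  refine mem_Pred.2 ⟨fun h' => ?_, fun h' => ?_⟩
  · exact hG.irrefl i (h'.trans_steps (.single (Or.inl h)))
  · exact hG.irrefl i (StrictDesc.steps_trans h'.steps (.of_arrow h))

lemma IsChainGraph.comp_subset_Nd (hG : G.IsChainGraph) (i : V) : G.comp i ⊆ G.Nd {i} :=
  fun _ hj => mem_Nd_singleton.2 fun h => hG.irrefl i (h.trans_steps (Linked.symm hj).steps)

lemma IsChainGraph.Fa_comp_subset (hG : G.IsChainGraph) (i : V) :
    G.Fa (G.comp i) ⊆ G.Pred i := by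
  rintro j ⟨k, hk, h⟩
  rw [Linked.Pred_eq hk]
  exact hG.mem_Pred_of_arrow (Or.inl h)

lemma IsChainGraph.Mo_comp_subset (hG : G.IsChainGraph) (i : V) :
    G.Mo (G.comp i) ⊆ G.Pred i := by
  rintro j ⟨k, hk, h⟩
  rw [Linked.Pred_eq hk]
  exact hG.mem_Pred_of_arrow (Or.inr h)

lemma Pa_eq (X : Set V) : G.Pa X = G.Fa X ∪ G.Mo X := by
  ext j
  simp only [Pa, Fa, Mo, Set.mem_ofPred_eq, Set.mem_union]
  constructor
  · rintro ⟨b, hb, h | h⟩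
    · exact Or.inl ⟨b, hb, h⟩
    · exact Or.inr ⟨b, hb, h⟩
  · rintro (⟨b, hb, h⟩ | ⟨b, hb, h⟩)
    · exact ⟨b, hb, Or.inl h⟩
    · exact ⟨b, hb, Or.inr h⟩

lemma Fa_singleton (i j : V) : j ∈ G.Fa {i} ↔ G.solid j i := by simp [Fa]

lemma Mo_singleton (i j : V) : j ∈ G.Mo {i} ↔ G.dashed j i := by simp [Mo]

lemma Ne_singleton (i j : V) : j ∈ G.Ne {i} ↔ G.line j i := by simp [Ne]

lemma IsUCG.notMem_Mo (hG : G.IsUCG) {i j : V} (h : j ∈ G.Fa (G.comp i)) :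
    j ∉ G.Mo (G.comp i) :=
  Set.disjoint_left.1 (hG.disjoint_Fa_Mo _ (comp_mem_Cc i)) h

/-- If a node outside the chain component of `i` is not a descendant of `i`, then neither are the
parents of its chain component. -/
lemma mem_Pred_of_arrow_linked {i k : V} (hk : k ∈ G.Pred i)
    {j l : V} (hl : G.Linked k l) (h : G.Arrow j l) : j ∈ G.Pred i := by
  obtain ⟨h1, -⟩ := mem_Pred.1 hk
  refine mem_Pred.2 ⟨fun h' => h1 ?_, fun h' => h1 ?_⟩
  · exact (h'.trans_steps (.single (Or.inl h))).trans_steps hl.symm.steps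
  · exact (StrictDesc.steps_trans h'.steps (.of_arrow h)).trans_steps hl.symm.steps

lemma mem_Pred_of_linked {i k l : V} (hk : k ∈ G.Pred i) (h : G.Linked k l) : l ∈ G.Pred i := by
  obtain ⟨h1, h2⟩ := mem_Pred.1 hk
  exact mem_Pred.2 ⟨fun h' => h1 (h'.trans_steps h.symm.steps), fun h' => h2 (h'.trans h.symm)⟩

lemma IsChainGraph.mem_Pred_or (hG : G.IsChainGraph) {i k : V} (h : ¬ G.Linked i k) :
    k ∈ G.Pred i ∨ i ∈ G.Pred k := by
  by_contra! h'
  simp only [mem_Pred, not_and_or, not_not] at h'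
  obtain ⟨h1, h2⟩ := h'
  have h3 := h1.resolve_right h
  have h4 := h2.resolve_right fun h'' => h h''.symm
  exact hG.irrefl i (h3.trans_steps h4.steps)

end MixedGraph

/-! ### Existence and uniqueness of regressions -/

section Resid

variable {V : Type*} [Fintype V] {A : Matrix V V ℝ}

/-- The quadratic form of `A` vanishes at `x`, since at each node either `x` or `A *ᵥ x` does. This
is the uniqueness principle behind regressions, and it is also applied to `W` component by
component. -/
lemma Matrix.PosDef.eq_zero_of_restrict (hA : A.PosDef) {S : Set V} {x : V → ℝ}
    (h : ∀ j, j ∉ S → x j = 0) (h' : ∀ j ∈ S, (A *ᵥ x) j = 0) : x = 0 := by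
  by_contra hx
  have h1 := hA.dotProduct_mulVec_pos hx
  refine h1.ne' (Finset.sum_eq_zero fun j _ => ?_)
  by_cases hj : j ∈ S
  · rw [h' j hj, mul_zero]
  · simp [h j hj]

lemma IsResid.ext (hA : A.PosDef) {S : Set V} {a : V} {g g' : V → ℝ} (hg : IsResid A S a g)
    (hg' : IsResid A S a g') : g = g' := by
  rw [← sub_eq_zero]
  refine hA.eq_zero_of_restrict (S := S) (fun j hj => ?_) fun j hj => ?_
  · by_cases h : j = a
    · simp [h, hg.self, hg'.self]
    · simp [hg.zero j hj h, hg'.zero j hj h]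
  · simp [Matrix.mulVec_sub, hg.orth j hj, hg'.orth j hj]

lemma exists_isResid (hA : A.PosDef) {S : Set V} {a : V} (ha : a ∉ S) : ∃ g, IsResid A S a g := by
  classical
  -- A square system: the rows in `S` express orthogonality, the others prescribe the entries.
  -- Injectivity makes it solvable.
  let T : (V → ℝ) →ₗ[ℝ] (V → ℝ) :=
    LinearMap.pi fun j => if j ∈ S then LinearMap.proj j ∘ₗ A.mulVecLin else LinearMap.proj j
  have hT : ∀ x j, T x j = if j ∈ S then (A *ᵥ x) j else x j := by
    intro x j
    by_cases hj : j ∈ S <;> simp [T, hj]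
  have hinj : Function.Injective T := by
    rw [injective_iff_map_eq_zero]
    intro x hx
    refine hA.eq_zero_of_restrict (S := S) (fun j hj => ?_) fun j hj => ?_
    · have := congrFun hx j
      rwa [hT, if_neg hj] at this
    · have := congrFun hx j
      rwa [hT, if_pos hj] at this
  obtain ⟨g, hg⟩ := LinearMap.injective_iff_surjective.1 hinj (Pi.single a 1)
  refine ⟨g, ?_, fun j hj hja => ?_, fun j hj => ?_⟩
  · have := congrFun hg a
    rwa [hT, if_neg ha, Pi.single_eq_same] at this
  · have := congrFun hg j
    rwa [hT, if_neg hj, Pi.single_eq_of_ne hja] at this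
  · have := congrFun hg j
    rwa [hT, if_pos hj, Pi.single_eq_of_ne (ne_of_mem_of_not_mem hj ha)] at this

lemma IsResid.mono {S T : Set V} (hST : S ⊆ T) {a : V} {g : V → ℝ} (hg : IsResid A S a g)
    (h : ∀ j ∈ T \ S, (A *ᵥ g) j = 0) : IsResid A T a g :=
  ⟨hg.self, fun j hj => hg.zero j fun h => hj (hST h), fun j hj => by
    by_cases hS : j ∈ S
    · exact hg.orth j hS
    · exact h j ⟨hj, hS⟩⟩

lemma IsResid.anti {S T : Set V} (hST : S ⊆ T) {a : V} {g : V → ℝ}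
    (hg : IsResid A T a g) (h : ∀ j ∈ T \ S, g j = 0) : IsResid A S a g :=
  ⟨hg.self, fun j hj hja => by
    by_cases hT : j ∈ T
    · exact h j ⟨hT, hj⟩
    · exact hg.zero j hT hja, fun j hj => hg.orth j (hST hj)⟩

/-- Conditional independence of a coordinate of a Gaussian vector, in terms of regression
coefficients. -/
lemma condIndepCoords_singleton_iff {p : Measure (V → ℝ)} [IsGaussian p]
    (hp : (covMatrix p).PosDef) {i : V} {Y T S : Set V} (hYT : Disjoint Y T) (hS : Y ∪ T = S)
    (hi : i ∉ S) {g : V → ℝ} (hg : IsResid (covMatrix p) S i g) :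
    CondIndepCoords p {i} Y T ↔ ∀ j ∈ Y, g j = 0 := by
  subst hS
  have hiT : i ∉ T := fun h => hi (Or.inr h)
  have hd : Disjoint {i} T := Set.disjoint_singleton_left.2 hiT
  have hdiff : (Y ∪ T) \ T = Y := by
    rw [Set.union_sdiff_right, hYT.sdiff_eq_left]
  constructor
  · intro h
    obtain ⟨g', hg'⟩ := exists_isResid hp hiT
    -- Independence makes the residual given `T` uncorrelated with `Y` as well, so it is the
    -- residual given `Y ∪ T`; by construction it has no coefficients on `Y`.
    have h2 : IsResid (covMatrix p) (Y ∪ T) i g' := hg'.mono Set.subset_union_right fun j hj => by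
      rw [hdiff] at hj
      exact h.mulVec_eq_zero hd rfl hj hg'
    intro j hj
    rw [hg.ext hp h2]
    exact hg'.zero j (Set.disjoint_left.1 hYT hj) fun h => hi (h ▸ Or.inl hj)
  · intro h
    refine condIndepCoords_of_resid hd fun a ha => ?_
    obtain rfl : a = i := ha
    refine ⟨g, hg.anti Set.subset_union_right ?_, fun b hb => hg.orth b (Or.inl hb)⟩
    rwa [hdiff]

end Resid

/-! ### Three Markov properties as vanishing regression coefficients -/

namespace MixedGraph

variable {V : Type*} {G : MixedGraph V}

lemma Pred_subset (i : V) : G.Pred i ⊆ G.Nd {i} \ {i} :=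
  fun _ hj => ⟨hj.1, fun h => hj.2 (Set.mem_singleton_iff.1 h ▸ mem_comp_self _)⟩

lemma notMem_Pred_self (i : V) : i ∉ G.Pred i := fun h => h.2 (mem_comp_self i)

lemma IsChainGraph.mem_Nd_diff (hG : G.IsChainGraph) {i j : V} :
    j ∈ G.Nd {i} \ {i} ↔ j ∈ G.Pred i ∨ (G.Linked i j ∧ j ≠ i) := by
  constructor
  · intro h
    by_cases hl : G.Linked i j
    · exact Or.inr ⟨hl, h.2⟩
    · exact Or.inl ⟨h.1, hl⟩
  · rintro (h | ⟨h, hji⟩)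
    · exact Pred_subset i h
    · exact ⟨hG.comp_subset_Nd i h, hji⟩

variable [Fintype V]

/-- The regression coefficients `g i` of `i` given the preceding chain components and `h i` of `i`
given all other non-descendants vanish where the unified chain graph requires it. -/
structure RegressionZeros (G : MixedGraph V) (g h : V → V → ℝ) : Prop where
  pred : ∀ i, ∀ j ∈ G.Pred i, j ∉ G.Fa (G.comp i) → ¬ G.dashed j i → g i j = 0
  full : ∀ i, ∀ j ∈ G.Pred i, ¬ G.solid j i → j ∉ G.Mo (G.comp i) → h i j = 0
  line : ∀ i j, G.Linked i j → j ≠ i → ¬ G.line j i → h i j = 0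

/-- The coefficients `g i` and `h i` come from the regressions of `i` given the preceding chain
components and given all other non-descendants. -/
structure IsRegression (G : MixedGraph V) (A : Matrix V V ℝ) (g h : V → V → ℝ) : Prop where
  pred : ∀ i, IsResid A (G.Pred i) i (g i)
  full : ∀ i, IsResid A (G.Nd {i} \ {i}) i (h i)

section Identity

variable {A : Matrix V V ℝ} {g h : V → V → ℝ}

lemma exists_isRegression (G : MixedGraph V) (hA : A.PosDef) : ∃ g h, G.IsRegression A g h := by
  have h1 : ∀ i, ∃ g, IsResid A (G.Pred i) i g := fun i => exists_isResid hA (notMem_Pred_self i)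
  have h2 : ∀ i, ∃ g, IsResid A (G.Nd {i} \ {i}) i g :=
    fun i => exists_isResid hA fun h => h.2 rfl
  choose g hg using h1
  choose h hh using h2
  exact ⟨g, h, hg, hh⟩

open Classical in
lemma IsRegression.g_eq (hr : G.IsRegression A g h) {i k j : V} (hk : G.Linked i k)
    (hj : j ∉ G.Pred i) : g k j = if j = k then 1 else 0 := by
  split_ifs with h
  · rw [h, (hr.pred k).self]
  · exact (hr.pred k).zero j (hk.Pred_eq ▸ hj) h

-- Outside `Pred i` each `g k` is the indicator of `k`, so the difference of the two sides is
-- supported on `Pred i`. All residuals involved are uncorrelated with `Pred i`, so the difference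
-- vanishes by positive definiteness.
open Classical in
lemma IsRegression.h_eq_sum (hG : G.IsChainGraph) (hA : A.PosDef) (hr : G.IsRegression A g h)
    (i j : V) : h i j = ∑ k, if G.Linked i k then h i k * g k j else 0 := by
  let c : V → ℝ := fun k => if G.Linked i k then h i k else 0
  have hx : h i - ∑ k, c k • g k = 0 := by
    refine hA.eq_zero_of_restrict (S := G.Pred i) (fun l hl => ?_) fun l hl => ?_
    · have h1 : ∀ k, c k * g k l = if l = k then c k else 0 := by
        intro k
        by_cases hk : G.Linked i k
        · rw [hr.g_eq hk hl]
          split_ifs <;> simp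
        · simp [c, hk]
      simp only [Pi.sub_apply, Finset.sum_apply, Pi.smul_apply, smul_eq_mul, h1,
        Finset.sum_ite_eq, Finset.mem_univ, if_true]
      by_cases hl' : G.Linked i l
      · simp [c, hl']
      · have : l ∉ G.Nd {i} \ {i} := fun h' =>
          (hG.mem_Nd_diff.1 h').elim hl fun h'' => hl' h''.1
        rw [(hr.full i).zero l this fun h' => hl' (h' ▸ Linked.refl _)]
        simp [c, hl']
    · have h1 : (A *ᵥ h i) l = 0 := (hr.full i).orth l (Pred_subset i hl)
      simp only [Matrix.mulVec_sub, Matrix.mulVec_sum, Matrix.mulVec_smul, Pi.sub_apply, h1,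
        Finset.sum_apply, Pi.smul_apply, smul_eq_mul, zero_sub, neg_eq_zero]
      refine Finset.sum_eq_zero fun k _ => ?_
      by_cases hk : G.Linked i k
      · rw [(hr.pred k).orth l (hk.Pred_eq ▸ hl), mul_zero]
      · simp [c, hk]
  have := congrFun hx j
  simp only [Pi.sub_apply, Finset.sum_apply, Pi.smul_apply, smul_eq_mul, Pi.zero_apply] at this
  rw [sub_eq_zero.1 this]
  refine Finset.sum_congr rfl fun k _ => ?_
  simp [c]

end Identity

section Equiv

variable {p : Measure (V → ℝ)} [IsGaussian p] {g h : V → V → ℝ}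

lemma first_block_iff (hG : G.IsChainGraph) (hp : (covMatrix p).PosDef)
    (hr : G.IsRegression (covMatrix p) g h) (i : V) :
    CondIndepCoords p {i} ((G.Pred i \ G.Fa (G.comp i)) \ G.Mo {i}) (G.Fa (G.comp i) ∪ G.Mo {i}) ↔
      ∀ j ∈ G.Pred i, j ∉ G.Fa (G.comp i) → ¬ G.dashed j i → g i j = 0 := by
  rw [condIndepCoords_singleton_iff hp _ _ (notMem_Pred_self i) (hr.pred i)]
  · simp only [Set.mem_sdiff, Mo_singleton]
    exact ⟨fun h j h1 h2 h3 => h j ⟨⟨h1, h2⟩, h3⟩, fun h j hj => h j hj.1.1 hj.1.2 hj.2⟩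
  · rw [Set.disjoint_left]
    rintro j ⟨⟨-, h1⟩, h2⟩ (h3 | h3)
    exacts [h1 h3, h2 h3]
  · ext j
    constructor
    · rintro (h1 | h1 | h1)
      · exact h1.1.1
      · exact hG.Fa_comp_subset i h1
      · exact hG.mem_Pred_of_arrow (Or.inr ((Mo_singleton i j).1 h1))
    · intro h1
      by_cases h2 : j ∈ G.Fa (G.comp i)
      · exact Or.inr (Or.inl h2)
      by_cases h3 : j ∈ G.Mo {i}
      · exact Or.inr (Or.inr h3)
      exact Or.inl ⟨⟨h1, h2⟩, h3⟩

lemma blockRecursiveMarkov_iff (hG : G.IsChainGraph) (hp : (covMatrix p).PosDef)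
    (hr : G.IsRegression (covMatrix p) g h) :
    G.BlockRecursiveMarkov p ↔ G.RegressionZeros g h := by
  have hi : ∀ i, i ∉ G.Nd {i} \ {i} := fun i h => h.2 rfl
  have b2 : ∀ i, CondIndepCoords p {i} ((G.Pred i \ G.Fa {i}) \ G.Mo (G.comp i))
      (((G.comp i \ {i}) ∪ G.Fa {i}) ∪ G.Mo (G.comp i)) ↔
      ∀ j ∈ G.Pred i, ¬ G.solid j i → j ∉ G.Mo (G.comp i) → h i j = 0 := by
    intro i
    rw [condIndepCoords_singleton_iff hp _ _ (hi i) (hr.full i)]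
    · simp only [Set.mem_sdiff, Fa_singleton]
      exact ⟨fun h j h1 h2 h3 => h j ⟨⟨h1, h2⟩, h3⟩, fun h j hj => h j hj.1.1 hj.1.2 hj.2⟩
    · rw [Set.disjoint_left]
      rintro j ⟨⟨h0, h1⟩, h2⟩ ((h3 | h3) | h3)
      exacts [h0.2 h3.1, h1 h3, h2 h3]
    · ext j
      rw [hG.mem_Nd_diff]
      constructor
      · rintro (h1 | (h1 | h1) | h1)
        · exact Or.inl h1.1.1
        · exact Or.inr h1
        · exact Or.inl (hG.mem_Pred_of_arrow (Or.inl ((Fa_singleton i j).1 h1)))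
        · exact Or.inl (hG.Mo_comp_subset i h1)
      · rintro (h1 | h1)
        · by_cases h2 : j ∈ G.Fa {i}
          · exact Or.inr (Or.inl (Or.inr h2))
          by_cases h3 : j ∈ G.Mo (G.comp i)
          · exact Or.inr (Or.inr h3)
          exact Or.inl ⟨⟨h1, h2⟩, h3⟩
        · exact Or.inr (Or.inl (Or.inl h1))
  -- (B3) conditions on the parents of the component instead of all preceding nodes. By (B2), `h i`
  -- vanishes at the other preceding nodes, so it is also the residual vector for this smaller set
  -- of regressors.
  have b3 : ∀ i, (∀ j ∈ G.Pred i, ¬ G.solid j i → j ∉ G.Mo (G.comp i) → h i j = 0) →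
      ∀ j ∈ (G.comp i \ {i}) \ G.Ne {i},
        (CondIndepCoords p {i} {j} ((G.comp i \ {i, j}) ∪ G.Pa (G.comp i)) ↔ h i j = 0) := by
    intro i h2 j hj
    have hsub : (G.comp i \ {i}) ∪ G.Pa (G.comp i) ⊆ G.Nd {i} \ {i} := by
      rw [Pa_eq]
      intro l hl
      rw [hG.mem_Nd_diff]
      rcases hl with hl | hl | hl
      · exact Or.inr hl
      · exact Or.inl (hG.Fa_comp_subset i hl)
      · exact Or.inl (hG.Mo_comp_subset i hl)
    have hPa : ∀ l ∈ G.Pa (G.comp i), l ∈ G.Pred i := by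
      rw [Pa_eq]
      rintro l (hl | hl)
      · exact hG.Fa_comp_subset i hl
      · exact hG.Mo_comp_subset i hl
    have hr' : IsResid (covMatrix p) ((G.comp i \ {i}) ∪ G.Pa (G.comp i)) i (h i) := by
      refine (hr.full i).anti hsub fun l hl => ?_
      rcases hG.mem_Nd_diff.1 hl.1 with h3 | h3
      · refine h2 l h3 (fun h4 => hl.2 (Or.inr ?_)) fun h4 => hl.2 (Or.inr ?_)
        · exact ⟨i, mem_comp_self i, Or.inl h4⟩
        · rw [Pa_eq]
          exact Or.inr h4
      · exact absurd (Or.inl h3) hl.2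
    rw [condIndepCoords_singleton_iff hp _ _ (fun h' => hi i (hsub h')) hr']
    · simp
    · rw [Set.disjoint_singleton_left]
      rintro (h3 | h3)
      · exact h3.2 (Or.inr rfl)
      · exact (hPa j h3).2 hj.1.1
    · ext l
      constructor
      · rintro (h3 | h3 | h3)
        · rw [Set.mem_singleton_iff.1 h3]
          exact Or.inl hj.1
        · exact Or.inl ⟨h3.1, fun h4 => h3.2 (Or.inl h4)⟩
        · exact Or.inr h3
      · rintro (h3 | h3)
        · by_cases h4 : l = j
          · exact Or.inl h4
          · exact Or.inr (Or.inl ⟨h3.1, fun h5 => h5.elim h3.2 h4⟩)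
        · exact Or.inr (Or.inr h3)
  rw [BlockRecursiveMarkov, forall_mem_Cc]
  simp only [Nd_comp]
  constructor
  · intro H
    refine ⟨fun i => (first_block_iff hG hp hr i).1 (H i).1, fun i => (b2 i).1 (H i).2.1,
      fun i j h1 h2 h3 => ?_⟩
    have hj : j ∈ (G.comp i \ {i}) \ G.Ne {i} := ⟨⟨h1, h2⟩, fun h4 => h3 ((Ne_singleton i j).1 h4)⟩
    exact (b3 i ((b2 i).1 (H i).2.1) j hj).1 ((H i).2.2 j hj)
  · intro H i
    refine ⟨(first_block_iff hG hp hr i).2 (H.pred i), (b2 i).2 (H.full i), fun j hj => ?_⟩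
    exact (b3 i (H.full i) j hj).2
      (H.line i j hj.1.1 hj.1.2 fun h4 => hj.2 ((Ne_singleton i j).2 h4))

lemma pairwiseMarkov_iff (hG : G.IsChainGraph) (hp : (covMatrix p).PosDef)
    (hr : G.IsRegression (covMatrix p) g h) :
    G.PairwiseMarkov p ↔ G.RegressionZeros g h := by
  have hi : ∀ i, i ∉ G.Nd {i} \ {i} := fun i h => h.2 rfl
  have p1 : ∀ i, ∀ j ∈ G.Pred i, (CondIndepCoords p {i} {j} (G.Pred i \ {j}) ↔ g i j = 0) := by
    intro i j hj
    rw [condIndepCoords_singleton_iff hp (Set.disjoint_sdiff_right) _ (notMem_Pred_self i)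
      (hr.pred i)]
    · simp
    · rw [Set.union_sdiff_self, Set.singleton_union, Set.insert_eq_of_mem hj]
  have p2 : ∀ i, ∀ j ∈ G.Nd {i} \ {i},
      (CondIndepCoords p {i} {j} (G.Nd {i} \ {i, j}) ↔ h i j = 0) := by
    intro i j hj
    have he : G.Nd {i} \ {i, j} = (G.Nd {i} \ {i}) \ {j} := by
      ext l
      simp [not_or, and_assoc]
    rw [he, condIndepCoords_singleton_iff hp (Set.disjoint_sdiff_right) _ (hi i) (hr.full i)]
    · simp
    · rw [Set.union_sdiff_self, Set.singleton_union, Set.insert_eq_of_mem hj]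
  have adj : ∀ {i j}, G.skeleton.Adj i j ↔ G.Step i j ∨ G.Step j i := Iff.rfl
  rw [PairwiseMarkov, forall_mem_Cc]
  constructor
  · intro H
    refine ⟨fun i j hj h1 h2 => ?_, fun i j hj h1 h2 => ?_, fun i j hj h0 h1 => ?_⟩
    · have hadj : ¬ G.skeleton.Adj i j := by
        rintro ((h3 | h3) | ((h3 | h3) | h3))
        · exact (mem_Pred.1 hj).1 (.of_arrow h3)
        · exact hj.2 (linked_of_line h3)
        · exact h1 ⟨i, mem_comp_self i, h3⟩
        · exact h2 h3
        · exact hj.2 (linked_of_line h3).symm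
      exact (p1 i j hj).1 ((H i j hadj).1 ⟨⟨hj, h1⟩, fun h3 => h2 ((Mo_singleton i j).1 h3)⟩)
    · have hadj : ¬ G.skeleton.Adj i j := by
        rintro ((h3 | h3) | ((h3 | h3) | h3))
        · exact (mem_Pred.1 hj).1 (.of_arrow h3)
        · exact hj.2 (linked_of_line h3)
        · exact h1 h3
        · exact h2 ⟨i, mem_comp_self i, h3⟩
        · exact hj.2 (linked_of_line h3).symm
      have hj' := Pred_subset i hj
      exact (p2 i j hj').1 ((H i j hadj).2 ⟨⟨hj', fun h3 => h1 ((Fa_singleton i j).1 h3)⟩, h2⟩)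
    · have hadj : ¬ G.skeleton.Adj i j := by
        rintro ((h3 | h3) | (h3 | h3))
        · exact mem_Nd_singleton.1 (hG.comp_subset_Nd i hj) (.of_arrow h3)
        · exact h1 (G.line_symm _ _ h3)
        · exact (hG.mem_Pred_of_arrow h3).2 hj
        · exact h1 h3
      have hj' := hG.mem_Nd_diff.2 (Or.inr ⟨hj, h0⟩)
      refine (p2 i j hj').1 ((H i j hadj).2 ⟨⟨hj', fun h3 => ?_⟩, fun h3 => ?_⟩)
      · exact hadj (Or.inr (Or.inl (Or.inl ((Fa_singleton i j).1 h3))))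
      · exact (hG.Mo_comp_subset i h3).2 hj
  · intro H i j hadj
    refine ⟨fun hj => (p1 i j hj.1.1).2 ?_, fun hj => (p2 i j hj.1.1).2 ?_⟩
    · exact H.pred i j hj.1.1 hj.1.2 fun h1 => hj.2 ((Mo_singleton i j).2 h1)
    · rcases hG.mem_Nd_diff.1 hj.1.1 with h1 | ⟨h1, h2⟩
      · exact H.full i j h1 (fun h3 => hj.1.2 ((Fa_singleton i j).2 h3)) hj.2
      · exact H.line i j h1 h2 fun h3 => hadj (Or.inr (Or.inr h3))

/-- (L2) contains zeros that are not in the list: those of `h i j` for a mother `j` of the component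
that is a mother neither of `i` nor of a neighbor of `i`. They follow from `h_eq_sum`: a factor `h i
k` survives only for `k = i` or a neighbor `k`, and then `g k j = 0`, because `j` is not a mother of
`k` and a mother of the component is never one of its fathers. -/
lemma localMarkov_iff (hG : G.IsUCG) (hp : (covMatrix p).PosDef)
    (hr : G.IsRegression (covMatrix p) g h) :
    G.LocalMarkov p ↔ G.RegressionZeros g h := by
  classical
  have hc := hG.isChainGraph
  have hi : ∀ i, i ∉ G.Nd {i} \ {i} := fun i h => h.2 rfl
  have l2 : ∀ i, CondIndepCoords p {i}
      ((((G.Nd {i} \ {i}) \ G.Pa {i}) \ G.Ne {i}) \ G.Mo (G.Ne {i}))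
      ((G.Pa {i} ∪ G.Ne {i}) ∪ G.Mo (G.Ne {i})) ↔
      ∀ j ∈ G.Nd {i} \ {i}, ¬ G.Arrow j i → ¬ G.line j i → j ∉ G.Mo (G.Ne {i}) → h i j = 0 := by
    intro i
    have hPa : ∀ j, j ∈ G.Pa {i} ↔ G.Arrow j i := fun j => by simp [Pa, Arrow]
    rw [condIndepCoords_singleton_iff hp _ _ (hi i) (hr.full i)]
    · simp only [Set.mem_sdiff (s := _ \ _), Ne_singleton, hPa]
      exact ⟨fun h j h1 h2 h3 h4 => h j ⟨⟨⟨h1, h2⟩, h3⟩, h4⟩,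
        fun h j hj => h j hj.1.1.1 hj.1.1.2 hj.1.2 hj.2⟩
    · rw [Set.disjoint_left]
      rintro j ⟨⟨⟨h0, h1⟩, h2⟩, h3⟩ ((h4 | h4) | h4)
      exacts [h1 h4, h2 h4, h3 h4]
    · ext j
      constructor
      · rintro (h1 | (h1 | h1) | ⟨k, h1, h2⟩)
        · exact h1.1.1.1
        · exact Pred_subset i (hc.mem_Pred_of_arrow ((hPa j).1 h1))
        · rw [Ne_singleton] at h1
          refine hc.mem_Nd_diff.2 (Or.inr ⟨(linked_of_line h1).symm, ?_⟩)
          rintro rfl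
          exact G.line_irrefl _ h1
        · rw [Ne_singleton] at h1
          exact Pred_subset i (hc.Mo_comp_subset i ⟨k, (linked_of_line h1).symm, h2⟩)
      · intro h1
        by_cases h2 : j ∈ G.Pa {i}
        · exact Or.inr (Or.inl (Or.inl h2))
        by_cases h3 : j ∈ G.Ne {i}
        · exact Or.inr (Or.inl (Or.inr h3))
        by_cases h4 : j ∈ G.Mo (G.Ne {i})
        · exact Or.inr (Or.inr h4)
        exact Or.inl ⟨⟨⟨h1, h2⟩, h3⟩, h4⟩
  rw [LocalMarkov, forall_mem_Cc]
  constructor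
  · intro H
    refine ⟨fun i => (first_block_iff hc hp hr i).1 (H i).1, fun i j h1 h2 h3 => ?_,
      fun i j h1 h2 h3 => ?_⟩
    · refine (l2 i).1 (H i).2 j (Pred_subset i h1) ?_ ?_ ?_
      · rintro (h4 | h4)
        · exact h2 h4
        · exact h3 ⟨i, mem_comp_self i, h4⟩
      · exact fun h4 => h1.2 (linked_of_line h4).symm
      · rintro ⟨k, h4, h5⟩
        exact h3 ⟨k, (linked_of_line ((Ne_singleton i k).1 h4)).symm, h5⟩
    · refine (l2 i).1 (H i).2 j (hc.mem_Nd_diff.2 (Or.inr ⟨h1, h2⟩)) ?_ h3 ?_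
      · exact fun h4 => (hc.mem_Pred_of_arrow h4).2 h1
      · rintro ⟨k, h4, h5⟩
        exact (hc.Mo_comp_subset i ⟨k, (linked_of_line ((Ne_singleton i k).1 h4)).symm, h5⟩).2 h1
  · intro H i
    refine ⟨(first_block_iff hc hp hr i).2 (H.pred i), (l2 i).2 fun j h1 h2 h3 h4 => ?_⟩
    rcases hc.mem_Nd_diff.1 h1 with h5 | ⟨h5, h6⟩
    · by_cases h6 : j ∈ G.Mo (G.comp i)
      · rw [hr.h_eq_sum hc hp]
        refine Finset.sum_eq_zero fun k _ => ?_
        split_ifs with hk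
        · by_cases hki : k = i ∨ G.line k i
          · rw [H.pred k j (hk.Pred_eq ▸ h5), mul_zero]
            · exact fun h7 => hG.notMem_Mo (hk.comp_eq ▸ h7) h6
            · rcases hki with rfl | hki
              · exact fun h7 => h2 (Or.inr h7)
              · exact fun h7 => h4 ⟨k, (Ne_singleton i k).2 hki, h7⟩
          · rw [not_or] at hki
            rw [H.line i k hk hki.1 hki.2, zero_mul]
        · rfl
      · exact H.full i j h5 (fun h7 => h2 (Or.inl h7)) h6
    · exact H.line i j h5 h6 h3

end Equiv

end MixedGraph

/-! ### Factorization of the inverse covariance matrix -/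

namespace MixedGraph

variable {V : Type*} {G : MixedGraph V} [Fintype V]

open Classical in
/-- A factorization of the inverse of `A` into matrices whose supports are given by the undirected,
dashed and solid edges of `G`. -/
structure Factorization (G : MixedGraph V) (A W B F : Matrix V V ℝ) : Prop where
  posDef : W.PosDef
  line : ∀ i j, W i j ≠ 0 → i = j ∨ G.line i j
  dashed : ∀ i j, B i j ≠ 0 → G.dashed j i
  father : ∀ i j, F i j ≠ 0 → j ∈ G.Fa (G.comp i)
  solid : ∀ i j, (W * F) i j ≠ 0 → G.solid j i
  factor : (1 - B - F)ᵀ * (W * (1 - B - F) * A) = 1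

/-- The entry is the residual variance `h i ⬝ᵥ A *ᵥ h i`. -/
lemma IsRegression.full_pos {A : Matrix V V ℝ} (hA : A.PosDef)
    {g h : V → V → ℝ} (hr : G.IsRegression A g h) (i : V) : 0 < (A *ᵥ h i) i := by
  have hne : h i ≠ 0 := fun h0 => by
    have := (hr.full i).self
    simp [h0] at this
  have h1 := hA.dotProduct_mulVec_pos hne
  have h2 : star (h i) ⬝ᵥ A *ᵥ h i = (A *ᵥ h i) i := by
    rw [dotProduct, Finset.sum_eq_single i]
    · simp [(hr.full i).self]
    · intro j _ hj
      by_cases hN : j ∈ G.Nd {i} \ {i}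
      · rw [(hr.full i).orth j hN, mul_zero]
      · simp [(hr.full i).zero j hN hj]
    · simp
  rwa [h2] at h1

/-- `W` consists of the rows `h i`, restricted to the component of `i` and divided by the residual
variance. By `h_eq_sum`, the product of `W` with the matrix of rows `g k` has the rows `h i` divided
by that variance, and `h i` is `A`-orthogonal to `g k` for `k ≠ i`. -/
lemma exists_factorization (hG : G.IsUCG) {A : Matrix V V ℝ} (hA : A.PosDef) {g h : V → V → ℝ}
    (hr : G.IsRegression A g h) (H : G.RegressionZeros g h) :
    ∃ W B F : Matrix V V ℝ, G.Factorization A W B F := by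
  classical
  have hc := hG.isChainGraph
  have hs := hr.full_pos hA
  let W : Matrix V V ℝ := Matrix.of fun i k => if G.Linked i k then h i k / (A *ᵥ h i) i else 0
  let B : Matrix V V ℝ := Matrix.of fun i j => if G.dashed j i then - g i j else 0
  let F : Matrix V V ℝ := Matrix.of fun i j => if j ∈ G.Fa (G.comp i) then - g i j else 0
  have hU : 1 - B - F = Matrix.of g := by
    ext i j
    simp only [Matrix.sub_apply, Matrix.one_apply, B, F, Matrix.of_apply]
    by_cases hj : j ∈ G.Pred i
    · have hij : i ≠ j := fun h' => notMem_Pred_self j (h' ▸ hj)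
      rw [if_neg hij]
      by_cases hd : G.dashed j i
      -- Disjointness of fathers and mothers: no coefficient is counted in both `B` and `F`.
      · have hF : j ∉ G.Fa (G.comp i) := fun h' => hG.notMem_Mo h' ⟨i, mem_comp_self i, hd⟩
        simp [hd, hF]
      · by_cases hF : j ∈ G.Fa (G.comp i)
        · simp [hd, hF]
        · simp [hd, hF, H.pred i j hj hF hd]
    · have hd : ¬ G.dashed j i := fun h' => hj (hc.mem_Pred_of_arrow (Or.inr h'))
      have hF : j ∉ G.Fa (G.comp i) := fun h' => hj (hc.Fa_comp_subset i h')
      rw [hr.g_eq (Linked.refl i) hj]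
      simp [hd, hF, eq_comm]
  have hWU : ∀ i j, (W * Matrix.of g) i j = h i j / (A *ᵥ h i) i := by
    intro i j
    rw [hr.h_eq_sum hc hA i j, Finset.sum_div, Matrix.mul_apply]
    refine Finset.sum_congr rfl fun k _ => ?_
    by_cases hk : G.Linked i k
    · simp only [W, Matrix.of_apply, hk, if_true]
      ring
    · simp [W, hk]
  have hsymm : ∀ x y : V → ℝ, x ⬝ᵥ A *ᵥ y = (A *ᵥ x) ⬝ᵥ y := by
    intro x y
    have hT : Aᵀ = A := by
      have := hA.isHermitian
      rwa [Matrix.IsHermitian, Matrix.conjTranspose_eq_transpose_of_trivial] at this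
    rw [Matrix.dotProduct_mulVec, ← Matrix.mulVec_transpose, hT]
  have hone : W * Matrix.of g * A * (Matrix.of g)ᵀ = 1 := by
    ext i k
    have e1 : (W * Matrix.of g * A * (Matrix.of g)ᵀ) i k =
        (h i ⬝ᵥ A *ᵥ g k) / (A *ᵥ h i) i := by
      rw [Matrix.mul_assoc, Matrix.mul_apply, dotProduct, Finset.sum_div]
      refine Finset.sum_congr rfl fun j _ => ?_
      rw [hWU, div_mul_eq_mul_div]
      rfl
    rw [e1, Matrix.one_apply]
    by_cases hl : G.Linked i k
    · have e2 : h i ⬝ᵥ A *ᵥ g k = (A *ᵥ h i) i * g k i := by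
        rw [hsymm, dotProduct, Finset.sum_eq_single i]
        · intro j _ hj
          by_cases hN : j ∈ G.Pred i
          · rw [(hr.full i).orth j (Pred_subset i hN), zero_mul]
          · by_cases hlj : G.Linked i j
            · rw [(hr.full i).orth j (hc.mem_Nd_diff.2 (Or.inr ⟨hlj, hj⟩)), zero_mul]
            · rw [hr.g_eq hl hN, if_neg (fun h' : j = k => hlj (h' ▸ hl)), mul_zero]
        · simp
      rw [e2, mul_div_cancel_left₀ _ (hs i).ne', hr.g_eq hl (notMem_Pred_self i)]
    · have hik : i ≠ k := fun h' => hl (h' ▸ Linked.refl _)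
      rw [if_neg hik, div_eq_zero_iff]
      left
      -- `Pred k` need not lie in `Pred i`. The required zeros confine the support of `g k` to `k`
      -- and parents of its component, and these do precede `i`. The other case confines the support
      -- of `h i` in the same way.
      rcases hc.mem_Pred_or hl with hk | hk
      · rw [hsymm]
        refine Finset.sum_eq_zero fun j _ => ?_
        by_cases hj : j ∈ G.Pred i
        · rw [(hr.full i).orth j (Pred_subset i hj), zero_mul]
        · have hjk : j ≠ k := fun h' => hj (h' ▸ hk)
          by_cases hjk' : j ∈ G.Pred k
          · rw [H.pred k j hjk', mul_zero]
            · rintro ⟨l, hl, h'⟩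
              exact hj (mem_Pred_of_arrow_linked hk hl (Or.inl h'))
            · exact fun h' => hj (mem_Pred_of_arrow_linked hk (Linked.refl k) (Or.inr h'))
          · rw [(hr.pred k).zero j hjk' hjk, mul_zero]
      · refine Finset.sum_eq_zero fun j _ => ?_
        by_cases hj : j ∈ G.Pred k
        · rw [(hr.pred k).orth j hj, mul_zero]
        · have hji : j ≠ i := fun h' => hj (h' ▸ hk)
          by_cases hN : j ∈ G.Nd {i} \ {i}
          · rcases hc.mem_Nd_diff.1 hN with h1 | h1
            · rw [H.full i j h1, zero_mul]
              · exact fun h' => hj (mem_Pred_of_arrow_linked hk (Linked.refl i) (Or.inl h'))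
              · rintro ⟨l, hl, h'⟩
                exact hj (mem_Pred_of_arrow_linked hk hl (Or.inr h'))
            · exact absurd (mem_Pred_of_linked hk h1.1) hj
          · rw [(hr.full i).zero j hN hji, zero_mul]
  have hfac : (1 - B - F)ᵀ * (W * (1 - B - F) * A) = 1 := by
    rw [hU]
    exact mul_eq_one_comm.1 hone
  refine ⟨W, B, F, ?_, fun i j hij => ?_, fun i j hij => ?_, fun i j hij => ?_, fun i j hij => ?_,
    hfac⟩
  · have h1 : (1 - B - F)ᵀ * W * (1 - B - F) = A⁻¹ := by
      refine (Matrix.inv_eq_left_inv ?_).symm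
      rw [Matrix.mul_assoc, Matrix.mul_assoc, ← Matrix.mul_assoc W]
      exact hfac
    have hu : IsUnit (1 - B - F) := by
      rw [← Matrix.isUnit_transpose]
      exact IsUnit.of_mul_eq_one _ hfac
    have h2 := hA.inv
    rw [← h1] at h2
    refine (Matrix.IsUnit.posDef_star_left_conjugate_iff hu).1 ?_
    rwa [Matrix.star_eq_conjTranspose, Matrix.conjTranspose_eq_transpose_of_trivial]
  · by_contra! h'
    refine hij ?_
    simp only [W, Matrix.of_apply]
    split_ifs with hl
    · rw [H.line i j hl (Ne.symm h'.1) fun h'' => h'.2 (G.line_symm _ _ h''), zero_div]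
    · rfl
  · by_contra h'
    exact hij (if_neg h')
  · by_contra h'
    exact hij (if_neg h')
  · by_contra h'
    refine hij ?_
    by_cases hj : j ∈ G.Fa (G.comp i)
    -- Being a father of the component does not depend on the node chosen in it, so column `j` of
    -- `F` agrees with that of `-g` there. The entry is thus a multiple of `h i j`.
    · have e1 : (W * F) i j = - (W * Matrix.of g) i j := by
        rw [Matrix.mul_apply, Matrix.mul_apply, ← Finset.sum_neg_distrib]
        refine Finset.sum_congr rfl fun k _ => ?_
        by_cases hk : G.Linked i k
        · have : j ∈ G.Fa (G.comp k) := hk.comp_eq ▸ hj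
          simp [F, this]
        · simp [W, hk]
      rw [e1, hWU, H.full i j (hc.Fa_comp_subset i hj) h' (hG.notMem_Mo hj)]
      simp
    · rw [Matrix.mul_apply]
      refine Finset.sum_eq_zero fun k _ => ?_
      by_cases hk : G.Linked i k
      · have : j ∉ G.Fa (G.comp k) := fun h' => hj (hk.comp_eq ▸ h')
        simp [F, this]
      · simp [W, hk]

end MixedGraph

/-! ### The truncation argument -/

/-- Masking a vector by `S` masks the entry `i` of its image under `M`, if all the coordinates that
contribute to this entry are treated alike. -/
lemma Matrix.mulVec_mask {V : Type*} [Fintype V] (M : Matrix V V ℝ) (x : V → ℝ) (S : V → Prop)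
    [DecidablePred S] (i : V) (q : Prop) [Decidable q] (h : ∀ j, M i j ≠ 0 → x j ≠ 0 → (S j ↔ q)) :
    (M *ᵥ fun j => if S j then x j else 0) i = if q then (M *ᵥ x) i else 0 := by
  have h1 : ∀ j, M i j * (if S j then x j else 0) = if q then M i j * x j else 0 := by
    intro j
    by_cases hM : M i j = 0
    · simp [hM]
    by_cases hx : x j = 0
    · simp [hx]
    by_cases hq : q
    · simp [hq, (h j hM hx).2 hq]
    · simp [hq, mt (h j hM hx).1 hq]
  simp only [Matrix.mulVec, dotProduct, h1]
  split_ifs <;> simp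

namespace MixedGraph

variable {V : Type*} {G : MixedGraph V} [Fintype V]

/-- If the nodes that are not `P` can be separated from `a` compatibly with the edges of `G`, then
they are conditionally uncorrelated with `a` given `Z`. Here `R` stands for the relevant nodes, and
`T` is a second mark for the chain components. -/
lemma Factorization.mulVec_eq_zero (hG : G.IsChainGraph) {A W B F : Matrix V V ℝ}
    (hf : G.Factorization A W B F) {Z : Set V} {a b : V} {γ : V → ℝ} (hγ : IsResid A Z a γ)
    {R P T : V → Prop} (hRZ : ∀ z ∈ Z, R z) (hRa : R a) (hRb : R b)
    (hRd : ∀ i j, G.dashed i j → R j → R i)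
    (hRs : ∀ i j k, G.solid i j → G.Linked j k → R k → R i) (hPa : P a) (hPb : ¬ P b)
    (h1 : ∀ m i, G.dashed m i → m ∉ Z → R i → (P m ↔ P i))
    (h2 : ∀ i j, G.line i j → ¬ (i ∈ Z ∧ ∀ m, G.dashed m i → m ∈ Z) →
      ¬ (j ∈ Z ∧ ∀ m, G.dashed m j → m ∈ Z) → (P i ↔ P j))
    (h3 : ∀ f i, G.solid f i → f ∉ Z → (∃ k, G.Linked i k ∧ R k) →
      ¬ (i ∈ Z ∧ ∀ m, G.dashed m i → m ∈ Z) → (P f ↔ P i))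
    (h4 : ∀ i j, G.line i j → (T i ↔ T j))
    (h5 : ∀ f i, G.solid f i → f ∉ Z → (∃ k, G.Linked i k ∧ R k) → (P f ↔ T i)) :
    (A *ᵥ γ) b = 0 := by
  classical
  -- `N` is the union of the components that meet `R`. At the nodes of `J` the vector `u` below
  -- vanishes, which is why the marks of their neighbors may disagree with theirs.
  let N : V → Prop := fun i => ∃ k, G.Linked i k ∧ R k
  let J : V → Prop := fun i => i ∈ Z ∧ ∀ m, G.dashed m i → m ∈ Z
  have hNR : ∀ i, R i → N i := fun i hi => ⟨i, Linked.refl i, hi⟩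
  have hNl : ∀ i j, G.Linked i j → (N i ↔ N j) := fun i j hij =>
    ⟨fun ⟨k, h, h'⟩ => ⟨k, hij.symm.trans h, h'⟩, fun ⟨k, h, h'⟩ => ⟨k, hij.trans h, h'⟩⟩
  have hNs : ∀ f i, G.solid f i → N i → R f := fun f i hs ⟨k, h, h'⟩ => hRs f i k hs h h'
  have hWl : ∀ i j, W i j ≠ 0 → G.Linked i j := fun i j hij => by
    rcases hf.line i j hij with rfl | h
    · exact Linked.refl _
    · exact linked_of_line h
  have hWT : Wᵀ = W := by
    have := hf.posDef.isHermitian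
    rwa [Matrix.IsHermitian, Matrix.conjTranspose_eq_transpose_of_trivial] at this
  -- With `U = 1 - B - F` one has `y = U *ᵥ c`, `w = W *ᵥ y` and `γ = Uᵀ *ᵥ w`. Entries of `F` only
  -- see the fathers of a whole component; passing to `C` recovers the solid edges.
  let C : Matrix V V ℝ := W * F
  let c : V → ℝ := A *ᵥ γ
  let u : V → ℝ := c - B *ᵥ c
  let t : V → ℝ := F *ᵥ c
  let y : V → ℝ := u - t
  let w : V → ℝ := W *ᵥ y
  have hcZ : ∀ z ∈ Z, c z = 0 := hγ.orth
  have hWt : W *ᵥ t = C *ᵥ c := Matrix.mulVec_mulVec _ _ _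
  have hγw : γ = w - Bᵀ *ᵥ w - Fᵀ *ᵥ w := by
    have e1 : (1 - B - F) *ᵥ c = y := by
      rw [Matrix.sub_mulVec, Matrix.sub_mulVec, Matrix.one_mulVec]
    have e2 : (1 - B - F)ᵀ *ᵥ w = γ := by
      have := congrArg (fun M : Matrix V V ℝ => M *ᵥ γ) hf.factor
      simp only [← Matrix.mulVec_mulVec, Matrix.one_mulVec] at this
      rwa [e1] at this
    rw [← e2, Matrix.transpose_sub, Matrix.transpose_sub, Matrix.sub_mulVec, Matrix.sub_mulVec,
      Matrix.transpose_one, Matrix.one_mulVec]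
  have hFw : Fᵀ *ᵥ w = Cᵀ *ᵥ y := by
    simp only [w, C, Matrix.transpose_mul, hWT, Matrix.mulVec_mulVec]
  have hγ0 : ∀ j, j ∉ Z → j ≠ a → w j = (Bᵀ *ᵥ w) j + (Fᵀ *ᵥ w) j := by
    intro j hj hja
    have := congrFun hγw j
    rw [hγ.zero j hj hja] at this
    simp only [Pi.sub_apply] at this
    linarith
  -- As `γ j = 0`, the value `w j` is a combination of values of `w` at strict descendants of `j`,
  -- which are not in `R` either because `R` is closed upwards. The induction runs from the bottom
  -- of the graph.
  have hw0 : ∀ j, ¬ R j → w j = 0 := by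
    intro j
    induction j using hG.wellFounded_swap.induction with
    | _ j ih =>
      intro hj
      rw [hγ0 j (fun h => hj (hRZ j h)) (fun h => hj (h ▸ hRa))]
      have e1 : (Bᵀ *ᵥ w) j = 0 := Finset.sum_eq_zero fun i _ => by
        by_cases hB : B i j = 0
        · simp [hB]
        · have hd := hf.dashed i j hB
          rw [ih i (.of_arrow (Or.inr hd)) fun h => hj (hRd j i hd h), mul_zero]
      have e2 : (Fᵀ *ᵥ w) j = 0 := Finset.sum_eq_zero fun i _ => by
        by_cases hF : F i j = 0
        · simp [hF]
        · obtain ⟨k, hk, hs⟩ := hf.father i j hF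
          have hki : G.Linked k i := Linked.symm hk
          rw [ih i ((StrictDesc.of_arrow (Or.inl hs)).trans_steps hki.steps)
            fun h => hj (hRs j k i hs hki h), mul_zero]
      rw [e1, e2, add_zero]
  -- `W` is block diagonal and `w = W *ᵥ y` vanishes on the components that miss `R`.
  have hy0 : ∀ i, ¬ N i → y i = 0 := by
    have hx : (fun j => if ¬ N j then y j else 0) = 0 := by
      refine hf.posDef.eq_zero_of_restrict (S := {i | ¬ N i}) (fun j hj => if_neg hj) fun j hj => ?_
      rw [Matrix.mulVec_mask W y (fun j => ¬ N j) j (¬ N j)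
        fun k hk _ => not_congr (hNl j k (hWl j k hk)).symm]
      exact (if_pos hj).trans (hw0 j fun h => hj (hNR j h))
    intro i hi
    have := congrFun hx i
    simpa [hi] using this
  have hu0 : ∀ i, J i → u i = 0 := by
    intro i hi
    have e1 : (B *ᵥ c) i = 0 := Finset.sum_eq_zero fun m _ => by
      by_cases hB : B i m = 0
      · simp [hB]
      · rw [hcZ m (hi.2 m (hf.dashed i m hB)), mul_zero]
    simp only [u, Pi.sub_apply, e1, hcZ i hi.1, sub_zero]
  -- `t` is cut by the mark `T` of the component, not by `P`: each `t i` collects the contributions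
  -- of all the fathers of the component.
  let d : V → ℝ := fun j => if R j ∧ ¬ P j then c j else 0
  let u' : V → ℝ := fun j => if N j ∧ ¬ P j then u j else 0
  let t' : V → ℝ := fun j => if N j ∧ ¬ T j then t j else 0
  let y' : V → ℝ := u' - t'
  let w' : V → ℝ := W *ᵥ y'
  have hy'0 : ∀ i, ¬ N i → y' i = 0 := fun i hi => by simp [y', u', t', hi]
  have f1 : ∀ i, N i → (W *ᵥ t') i = (C *ᵥ d) i := by
    intro i hi
    have e1 : (W *ᵥ t') i = if ¬ T i then (W *ᵥ t) i else 0 := by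
      refine Matrix.mulVec_mask W t (fun j => N j ∧ ¬ T j) i (¬ T i) fun j hW _ => ?_
      rw [and_iff_right ((hNl i j (hWl i j hW)).1 hi)]
      rcases hf.line i j hW with rfl | h
      · rfl
      · exact not_congr (h4 i j h).symm
    have e2 : (C *ᵥ d) i = if ¬ T i then (C *ᵥ c) i else 0 := by
      refine Matrix.mulVec_mask C c (fun j => R j ∧ ¬ P j) i (¬ T i) fun f hC hc => ?_
      have hs := hf.solid i f hC
      rw [and_iff_right (hNs f i hs hi), h5 f i hs (fun h => hc (hcZ f h)) hi]
    rw [e1, e2, hWt]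
  -- Outside `J`, every nonzero contribution to `w i` carries the mark of `i`, so truncation
  -- commutes with forming `w`.
  have f3 : ∀ i, N i → ¬ J i → w' i = if ¬ P i then w i else 0 := by
    intro i hi hJ
    have e1 : (W *ᵥ u') i = if ¬ P i then (W *ᵥ u) i else 0 := by
      refine Matrix.mulVec_mask W u (fun j => N j ∧ ¬ P j) i (¬ P i) fun j hW hu => ?_
      rw [and_iff_right ((hNl i j (hWl i j hW)).1 hi)]
      rcases hf.line i j hW with rfl | h
      · rfl
      · exact not_congr (h2 i j h hJ fun h => hu (hu0 j h)).symm
    have e2 : (C *ᵥ d) i = if ¬ P i then (C *ᵥ c) i else 0 := by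
      refine Matrix.mulVec_mask C c (fun j => R j ∧ ¬ P j) i (¬ P i) fun f hC hc => ?_
      have hs := hf.solid i f hC
      rw [and_iff_right (hNs f i hs hi), h3 f i hs (fun h => hc (hcZ f h)) hi hJ]
    have e3 : w' i = (W *ᵥ u') i - (W *ᵥ t') i := by
      simp only [w', y', Matrix.mulVec_sub, Pi.sub_apply]
    have e4 : w i = (W *ᵥ u) i - (C *ᵥ c) i := by
      simp only [w, y, Matrix.mulVec_sub, Pi.sub_apply, hWt]
    rw [e3, f1 i hi, e1, e2, e4]
    split_ifs <;> simp
  have f5 : ∀ i, ¬ R i → w' i = 0 := by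
    intro i hi
    by_cases hN : N i
    · rw [f3 i hN fun h => hi (hRZ i h.1), hw0 i hi, ite_self]
    · refine Finset.sum_eq_zero fun j _ => ?_
      by_cases hW : W i j = 0
      · simp [hW]
      · rw [hy'0 j fun h => hN ((hNl i j (hWl i j hW)).2 h), mul_zero]
  have f6 : ∀ i, R i → u' i = d i - (B *ᵥ d) i := by
    intro i hi
    have e1 : (B *ᵥ d) i = if ¬ P i then (B *ᵥ c) i else 0 := by
      refine Matrix.mulVec_mask B c (fun j => R j ∧ ¬ P j) i (¬ P i) fun m hB hc => ?_
      have hd := hf.dashed i m hB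
      rw [and_iff_right (hRd m i hd hi), h1 m i hd (fun h => hc (hcZ m h)) hi]
    rw [e1]
    simp only [u', d, hi, hNR i hi, true_and, u, Pi.sub_apply]
    split_ifs <;> simp
  -- Where `d j ≠ 0`, the node `j` is neither in `Z` nor equal to `a`, and no term of the bracket
  -- has been changed by the truncation; the bracket is then `γ j = 0`.
  have f7 : ∀ j, d j * (w' j - (Bᵀ *ᵥ w') j - (Cᵀ *ᵥ y') j) = 0 := by
    intro j
    by_cases hd : d j = 0
    · rw [hd, zero_mul]
    obtain ⟨⟨hR, hP⟩, hc⟩ : (R j ∧ ¬ P j) ∧ c j ≠ 0 := by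
      by_cases h : R j ∧ ¬ P j
      · exact ⟨h, fun h' => hd (by simp only [d, h', ite_self])⟩
      · exact absurd (if_neg h) hd
    have hZ : j ∉ Z := fun h => hc (hcZ j h)
    have e1 : w' j = w j := by rw [f3 j (hNR j hR) (fun h => hZ h.1), if_pos hP]
    have e2 : (Bᵀ *ᵥ w') j = (Bᵀ *ᵥ w) j := Finset.sum_congr rfl fun i _ => by
      by_cases hB : B i j = 0
      · simp [hB]
      have hd := hf.dashed i j hB
      by_cases hRi : R i
      · rw [f3 i (hNR i hRi) (fun h => hZ (h.2 j hd)), if_pos (mt (h1 j i hd hZ hRi).2 hP)]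
      · rw [f5 i hRi, hw0 i hRi]
    have e3 : (Cᵀ *ᵥ y') j = (Cᵀ *ᵥ y) j := Finset.sum_congr rfl fun i _ => by
      by_cases hC : C i j = 0
      · simp [hC]
      have hs := hf.solid i j hC
      by_cases hN : N i
      · have e4 : t' i = t i := if_pos ⟨hN, mt (h5 j i hs hZ hN).2 hP⟩
        have e5 : u' i = u i := by
          by_cases hu : u i = 0
          · simp only [u', hu, ite_self]
          · exact if_pos ⟨hN, mt (h3 j i hs hZ hN fun h => hu (hu0 i h)).2 hP⟩
        simp only [y', y, Pi.sub_apply, e4, e5]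
      · rw [hy'0 i hN, hy0 i hN]
    rw [e1, e2, e3, ← hFw, hγ0 j hZ fun h => hP (h ▸ hPa)]
    ring
  -- Moving `B` and `C` to the other side turns the quadratic form of `W` at `y'` into the sum of
  -- the products in `f7`.
  have hy' : y' = 0 := by
    by_contra hne
    have hpos := hf.posDef.dotProduct_mulVec_pos hne
    refine hpos.ne' ?_
    have e1 : u' ⬝ᵥ w' = (d - B *ᵥ d) ⬝ᵥ w' := Finset.sum_congr rfl fun i _ => by
      by_cases hR : R i
      · rw [f6 i hR, Pi.sub_apply]
      · rw [f5 i hR, mul_zero, mul_zero]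
    have e2 : t' ⬝ᵥ w' = (C *ᵥ d) ⬝ᵥ y' := by
      have : t' ⬝ᵥ w' = (W *ᵥ t') ⬝ᵥ y' := by
        rw [Matrix.dotProduct_mulVec, ← Matrix.mulVec_transpose, hWT]
      rw [this]
      refine Finset.sum_congr rfl fun i _ => ?_
      by_cases hN : N i
      · rw [f1 i hN]
      · rw [hy'0 i hN, mul_zero, mul_zero]
    have e3 : ∀ (M : Matrix V V ℝ) (x z : V → ℝ), (M *ᵥ x) ⬝ᵥ z = x ⬝ᵥ (Mᵀ *ᵥ z) := fun M x z => by
      rw [dotProduct_comm, Matrix.dotProduct_mulVec, dotProduct_comm, ← Matrix.mulVec_transpose]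
    calc star y' ⬝ᵥ W *ᵥ y' = u' ⬝ᵥ w' - t' ⬝ᵥ w' := sub_dotProduct _ _ _
      _ = d ⬝ᵥ (w' - Bᵀ *ᵥ w' - Cᵀ *ᵥ y') := by
        rw [e1, e2, sub_dotProduct, e3, e3, dotProduct_sub, dotProduct_sub]
      _ = 0 := Finset.sum_eq_zero fun j _ => f7 j
  have hut : u' = t' := sub_eq_zero.1 hy'
  -- On `R`, `d - B *ᵥ d = u' = t'`, while `W *ᵥ t' = C *ᵥ d`. So `d i` is determined by `d` at
  -- nodes of which `i` is a strict descendant, and induction from the top gives zero.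
  have hd0 : ∀ i, R i → d i = 0 := by
    intro i
    induction i using hG.wellFounded.induction with
    | _ i ih =>
      intro hi
      have e1 : (B *ᵥ d) i = 0 := Finset.sum_eq_zero fun m _ => by
        by_cases hB : B i m = 0
        · simp [hB]
        · have hd := hf.dashed i m hB
          rw [ih m (.of_arrow (Or.inr hd)) (hRd m i hd hi), mul_zero]
      have hx : (fun j => if G.Linked i j then u' j else 0) = 0 := by
        refine hf.posDef.eq_zero_of_restrict (S := G.comp i) (fun j hj => if_neg hj) fun j hj => ?_
        have hij : G.Linked i j := hj
        rw [Matrix.mulVec_mask W u' (fun j => G.Linked i j) j True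
          (fun k hk _ => iff_of_true (hij.trans (hWl j k hk)) trivial), if_pos trivial, hut,
          f1 j ((hNl i j hij).1 (hNR i hi))]
        refine Finset.sum_eq_zero fun f _ => ?_
        by_cases hC : C j f = 0
        · simp [hC]
        · have hs := hf.solid j f hC
          rw [ih f ((StrictDesc.of_arrow (Or.inl hs)).trans_steps hij.symm.steps)
            (hRs f j i hs hij.symm hi), mul_zero]
      have e2 : u' i = 0 := by
        have := congrFun hx i
        simpa [Linked.refl] using this
      have := f6 i hi
      rw [e1, e2] at this
      linarith
  have := hd0 b hRb
  rwa [show d b = c b from if_pos ⟨hRb, hPb⟩] at this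

end MixedGraph

/-! ### Edge marks and concatenation of open routes -/

namespace MixedGraph

variable {V : Type*} {G : MixedGraph V} {Z : Set V}

/-- The possible marks of an edge at one of its ends. -/
inductive Mark
  | tail
  | line
  | solid
  | dashed

/-- The edge between `x` and `y` has the given mark at `y`. -/
def Mark.At (G : MixedGraph V) : Mark → V → V → Prop
  | .tail, x, y => G.Arrow y x
  | .line, x, y => G.line x y
  | .solid, x, y => G.solid x y
  | .dashed, x, y => G.dashed x y

/-- The interior occurrences of the route `ρ` satisfy the conditions for being `Z`-open. -/
structure PreOpen (Z : Set V) {a b : V} (ρ : G.skeleton.Walk a b) : Prop where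
  collider_node : ∀ k, IsColliderNode ρ k → ρ.getVert k ∈ Z
  collider_section : ∀ s t, IsColliderSection ρ s t → ∃ k, s ≤ k ∧ k ≤ t ∧ ρ.getVert k ∈ Z
  other : ∀ k, 0 < k → k < ρ.length → ¬ IsColliderNode ρ k →
    (¬ ∃ s t, IsColliderSection ρ s t ∧ s ≤ k ∧ k ≤ t) → ρ.getVert k ∉ Z

/-- There is a route of positive length from `x` to `y` with `Z`-open interior whose first edge has
mark `m` at `x` and whose last edge has mark `n` at `y`. -/
def OpenVia (G : MixedGraph V) (Z : Set V) (m : Mark) (x y : V) (n : Mark) : Prop :=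
  ∃ ρ : G.skeleton.Walk x y, 0 < ρ.length ∧ PreOpen Z ρ ∧ m.At G (ρ.getVert 1) x ∧
    n.At G (ρ.getVert (ρ.length - 1)) y

lemma PreOpen.isOpenRoute {a b : V} {ρ : G.skeleton.Walk a b} (h : PreOpen Z ρ) (ha : a ∉ Z)
    (hb : b ∉ Z) : IsOpenRoute Z ρ := by
  refine ⟨h.collider_node, h.collider_section, fun k hk h1 h2 => ?_⟩
  rcases Nat.eq_zero_or_pos k with rfl | h0
  · simpa using ha
  rcases hk.eq_or_lt with rfl | hk
  · simpa using hb
  exact h.other k h0 hk h1 h2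

lemma Mark.At.tail_eq {x y : V} {m : Mark} (h : m.At G x y) (h' : G.Arrow y x) : m = .tail := by
  cases m
  · rfl
  · rcases h' with h' | h'
    · exact absurd ⟨G.line_symm _ _ h, h'⟩ (G.not_line_solid y x)
    · exact absurd ⟨G.line_symm _ _ h, h'⟩ (G.not_line_dashed y x)
  · rcases h' with h' | h'
    · exact absurd ⟨h, h'⟩ (G.not_solid_solid x y)
    · exact absurd ⟨h, h'⟩ (G.not_solid_dashed_rev x y)
  · rcases h' with h' | h'
    · exact absurd ⟨h', h⟩ (G.not_solid_dashed_rev y x)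
    · exact absurd ⟨h, h'⟩ (G.not_dashed_dashed x y)

lemma Mark.At.line_eq {x y : V} {m : Mark} (h : m.At G x y) (h' : G.line x y) : m = .line := by
  cases m
  · exact absurd (Mark.At.tail_eq (m := .line) h' h) (by simp)
  · rfl
  · exact absurd ⟨h', h⟩ (G.not_line_solid x y)
  · exact absurd ⟨h', h⟩ (G.not_line_dashed x y)

lemma Mark.At.solid_eq {x y : V} {m : Mark} (h : m.At G x y) (h' : G.solid x y) : m = .solid := by
  cases m
  · exact absurd (Mark.At.tail_eq (m := .solid) h' h) (by simp)
  · exact absurd ⟨h, h'⟩ (G.not_line_solid x y)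
  · rfl
  · exact absurd ⟨h', h⟩ (G.not_solid_dashed x y)

lemma Mark.At.dashed_eq {x y : V} {m : Mark} (h : m.At G x y) (h' : G.dashed x y) :
    m = .dashed := by
  cases m
  · exact absurd (Mark.At.tail_eq (m := .dashed) h' h) (by simp)
  · exact absurd ⟨h, h'⟩ (G.not_line_dashed x y)
  · exact absurd ⟨h, h'⟩ (G.not_solid_dashed x y)
  · rfl

lemma isColliderNode_congr {a b a' b' : V} {ρ : G.skeleton.Walk a b} {ρ' : G.skeleton.Walk a' b'}
    {k k' : ℕ} (hk : 0 < k ∧ k < ρ.length ↔ 0 < k' ∧ k' < ρ'.length)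
    (h1 : ρ.getVert (k - 1) = ρ'.getVert (k' - 1)) (h2 : ρ.getVert k = ρ'.getVert k')
    (h3 : ρ.getVert (k + 1) = ρ'.getVert (k' + 1)) :
    IsColliderNode ρ k ↔ IsColliderNode ρ' k' := by
  rw [IsColliderNode, IsColliderNode, h1, h2, h3, ← and_assoc, hk, and_assoc]

/-- Edges are unique, so the two marks at a node are determined and decide whether it is a collider
node. If both marks are `line` or `solid` it is not one, but it may still lie in a collider section,
which is not a local matter. -/
lemma isColliderNode_iff_at {a b : V} {ρ : G.skeleton.Walk a b} {k : ℕ} {m n : Mark}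
    (hk : 0 < k) (hk' : k < ρ.length) (hm : m.At G (ρ.getVert (k - 1)) (ρ.getVert k))
    (hn : n.At G (ρ.getVert (k + 1)) (ρ.getVert k)) :
    IsColliderNode ρ k ↔ m ≠ .tail ∧ n ≠ .tail ∧ (m = .dashed ∨ n = .dashed) := by
  have key : ∀ {x y z : V} {m n : Mark}, m.At G x y → n.At G z y →
      (G.dashed x y ∧ (G.dashed z y ∨ G.line y z ∨ G.solid z y) ↔ m = .dashed ∧ n ≠ .tail) := by
    intro x y z m n hm hn
    constructor
    · rintro ⟨h1, h2⟩
      refine ⟨hm.dashed_eq h1, ?_⟩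
      rcases h2 with h2 | h2 | h2
      · simp [hn.dashed_eq h2]
      · simp [hn.line_eq (G.line_symm _ _ h2)]
      · simp [hn.solid_eq h2]
    · rintro ⟨rfl, h2⟩
      refine ⟨hm, ?_⟩
      cases n
      · exact absurd rfl h2
      · exact Or.inr (Or.inl (G.line_symm _ _ hn))
      · exact Or.inr (Or.inr hn)
      · exact Or.inl hn
  rw [IsColliderNode, key hm hn, key hn hm]
  constructor
  · rintro ⟨-, -, ⟨rfl, h⟩ | ⟨rfl, h⟩⟩
    · exact ⟨by simp, h, Or.inl rfl⟩
    · exact ⟨h, by simp, Or.inr rfl⟩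
  · rintro ⟨h1, h2, rfl | rfl⟩
    · exact ⟨hk, hk', Or.inl ⟨rfl, h2⟩⟩
    · exact ⟨hk, hk', Or.inr ⟨rfl, h1⟩⟩

lemma IsColliderSection.at_prev {a b : V} {ρ : G.skeleton.Walk a b} {s t k : ℕ} {m : Mark}
    (h : IsColliderSection ρ s t) (hs : s ≤ k) (ht : k ≤ t)
    (hm : m.At G (ρ.getVert (k - 1)) (ρ.getVert k)) : m = .line ∨ m = .solid := by
  obtain ⟨h0, -, -, h1, h2, -⟩ := h
  rcases hs.eq_or_lt with rfl | hs
  · exact Or.inr (hm.solid_eq h1)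
  · have := h2 (k - 1) (by omega) (by omega)
    rw [Nat.sub_add_cancel (by omega)] at this
    exact Or.inl (hm.line_eq this)

lemma IsColliderSection.at_next {a b : V} {ρ : G.skeleton.Walk a b} {s t k : ℕ} {m : Mark}
    (h : IsColliderSection ρ s t) (hs : s ≤ k) (ht : k ≤ t)
    (hm : m.At G (ρ.getVert (k + 1)) (ρ.getVert k)) : m = .line ∨ m = .solid := by
  obtain ⟨h0, -, -, -, h2, h3⟩ := h
  rcases ht.eq_or_lt with rfl | ht
  · exact Or.inr (hm.solid_eq h3)
  · exact Or.inl (hm.line_eq (G.line_symm _ _ (h2 k hs ht)))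

section Append

variable {x y z : V} (ρ : G.skeleton.Walk x y) (σ : G.skeleton.Walk y z)

lemma getVert_append_left {i : ℕ} (hi : i ≤ ρ.length) :
    (ρ.append σ).getVert i = ρ.getVert i := by
  rw [SimpleGraph.Walk.getVert_append]
  split_ifs with h
  · rfl
  · obtain rfl : i = ρ.length := by omega
    simp

lemma getVert_append_right (i : ℕ) : (ρ.append σ).getVert (ρ.length + i) = σ.getVert i := by
  rw [SimpleGraph.Walk.getVert_append, if_neg (by omega), Nat.add_sub_cancel_left]

lemma isColliderSection_append_left {s t : ℕ} (ht : t < ρ.length) :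
    IsColliderSection (ρ.append σ) s t ↔ IsColliderSection ρ s t := by
  have e : ∀ {k}, k < ρ.length → (t < (ρ.append σ).length ↔ t < ρ.length) := fun _ =>
    iff_of_true (by rw [SimpleGraph.Walk.length_append]; omega) ht
  by_cases hst : 0 < s ∧ s ≤ t
  · rw [IsColliderSection, IsColliderSection, e ht, getVert_append_left ρ σ (by omega : s - 1 ≤ _),
      getVert_append_left ρ σ (by omega : s ≤ _), getVert_append_left ρ σ (by omega : t + 1 ≤ _),
      getVert_append_left ρ σ (by omega : t ≤ _)]
    refine and_congr_right fun _ => and_congr_right fun _ => and_congr_right fun _ =>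
      and_congr_right fun _ => and_congr_left fun _ => forall_congr' fun k =>
      forall_congr' fun _ => forall_congr' fun hk => ?_
    rw [getVert_append_left ρ σ (by omega : k ≤ _), getVert_append_left ρ σ (by omega : k + 1 ≤ _)]
  · exact iff_of_false (fun h => hst ⟨h.1, h.2.1⟩) (fun h => hst ⟨h.1, h.2.1⟩)

lemma isColliderSection_append_right {s t : ℕ} (hs : 0 < s) :
    IsColliderSection (ρ.append σ) (ρ.length + s) (ρ.length + t) ↔ IsColliderSection σ s t := by
  have e1 : ρ.length + s - 1 = ρ.length + (s - 1) := by omega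
  rw [IsColliderSection, IsColliderSection, e1, add_assoc, getVert_append_right,
    getVert_append_right, getVert_append_right, getVert_append_right,
    SimpleGraph.Walk.length_append]
  refine and_congr (by omega) (and_congr (by omega) (and_congr (by omega) (and_congr_right fun _ =>
    and_congr_left fun _ => ⟨fun h k h1 h2 => ?_, fun h k h1 h2 => ?_⟩)))
  · have := h (ρ.length + k) (by omega) (by omega)
    rwa [add_assoc, getVert_append_right, getVert_append_right] at this
  · obtain ⟨l, rfl⟩ := Nat.exists_eq_add_of_le (by omega : ρ.length ≤ k)
    rw [add_assoc, getVert_append_right, getVert_append_right]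
    exact h l (by omega) (by omega)

lemma isColliderNode_append_left {k : ℕ} (hk : k < ρ.length) :
    IsColliderNode (ρ.append σ) k ↔ IsColliderNode ρ k := by
  refine isColliderNode_congr ?_ (getVert_append_left ρ σ (by omega))
    (getVert_append_left ρ σ (by omega)) (getVert_append_left ρ σ (by omega))
  rw [SimpleGraph.Walk.length_append]
  omega

lemma isColliderNode_append_right {k : ℕ} (hk : 0 < k) :
    IsColliderNode (ρ.append σ) (ρ.length + k) ↔ IsColliderNode σ k := by
  refine isColliderNode_congr ?_ ?_ (getVert_append_right ρ σ k) ?_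
  · rw [SimpleGraph.Walk.length_append]
    omega
  · rw [Nat.add_sub_assoc (by omega), getVert_append_right]
  · rw [add_assoc, getVert_append_right]

end Append

/-- A tail or a dashed mark at `y` prevents any collider section from passing through `y`. So the
two marks alone decide the status of `y`, and every other position keeps its status. Junctions made
of `line` and `solid` marks only are left out, as they depend on the whole undirected part. -/
lemma OpenVia.join {x y z : V} {m n m' n' : Mark} (h1 : G.OpenVia Z m x y n)
    (h2 : G.OpenVia Z m' y z n')
    (h : y ∉ Z ∧ (n = .tail ∨ m' = .tail) ∨
      y ∈ Z ∧ n ≠ .tail ∧ m' ≠ .tail ∧ (n = .dashed ∨ m' = .dashed)) :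
    G.OpenVia Z m x z n' := by
  obtain ⟨ρ, hρ, oρ, hm, hn⟩ := h1
  obtain ⟨σ, hσ, oσ, hm', hn'⟩ := h2
  have hlen : (ρ.append σ).length = ρ.length + σ.length := SimpleGraph.Walk.length_append _ _
  have hy : (ρ.append σ).getVert ρ.length = y := by
    rw [getVert_append_left ρ σ le_rfl, SimpleGraph.Walk.getVert_length]
  have e1 : n.At G ((ρ.append σ).getVert (ρ.length - 1)) ((ρ.append σ).getVert ρ.length) := by
    rwa [hy, getVert_append_left ρ σ (by omega)]
  have e2 : m'.At G ((ρ.append σ).getVert (ρ.length + 1)) ((ρ.append σ).getVert ρ.length) := by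
    rwa [hy, getVert_append_right]
  have hsec : ∀ s t, IsColliderSection (ρ.append σ) s t → s ≤ ρ.length → ρ.length ≤ t → False := by
    intro s t hst hs ht
    have h3 := hst.at_prev hs ht e1
    have h4 := hst.at_next hs ht e2
    rcases h with ⟨-, rfl | rfl⟩ | ⟨-, -, -, rfl | rfl⟩ <;> simp at h3 h4
  refine ⟨ρ.append σ, by omega, ⟨fun k hk => ?_, fun s t hst => ?_, fun k h0 hk h3 h4 => ?_⟩, ?_, ?_⟩
  · rcases lt_trichotomy k ρ.length with hlt | rfl | hlt
    · rw [getVert_append_left ρ σ hlt.le]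
      exact oρ.collider_node k ((isColliderNode_append_left ρ σ hlt).1 hk)
    · rw [isColliderNode_iff_at hρ (by omega) e1 e2] at hk
      rw [hy]
      rcases h with ⟨-, rfl | rfl⟩ | h
      · exact absurd rfl hk.1
      · exact absurd rfl hk.2.1
      · exact h.1
    · obtain ⟨l, rfl⟩ := Nat.exists_eq_add_of_le hlt.le
      rw [getVert_append_right]
      exact oσ.collider_node l ((isColliderNode_append_right ρ σ (by omega)).1 hk)
  · by_cases ht : t < ρ.length
    · obtain ⟨k, h3, h4, h5⟩ := oρ.collider_section s t
        ((isColliderSection_append_left ρ σ ht).1 hst)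
      exact ⟨k, h3, h4, by rwa [getVert_append_left ρ σ (by omega)]⟩
    · by_cases hs : s ≤ ρ.length
      · exact absurd (not_lt.1 ht) fun ht => hsec s t hst hs ht
      · obtain ⟨s', rfl⟩ := Nat.exists_eq_add_of_le (not_le.1 hs).le
        obtain ⟨t', rfl⟩ := Nat.exists_eq_add_of_le (not_lt.1 ht)
        obtain ⟨k, h3, h4, h5⟩ := oσ.collider_section s' t'
          ((isColliderSection_append_right ρ σ (by omega)).1 hst)
        exact ⟨ρ.length + k, by omega, by omega, by rwa [getVert_append_right]⟩
  · rcases lt_trichotomy k ρ.length with hlt | rfl | hlt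
    · rw [getVert_append_left ρ σ hlt.le]
      refine oρ.other k h0 hlt (fun h5 => h3 ((isColliderNode_append_left ρ σ hlt).2 h5)) ?_
      rintro ⟨s, t, h5, h6, h7⟩
      exact h4 ⟨s, t, (isColliderSection_append_left ρ σ h5.2.2.1).2 h5, h6, h7⟩
    · rw [isColliderNode_iff_at hρ (by omega) e1 e2] at h3
      rw [hy]
      rcases h with h | h
      · exact h.1
      · exact absurd h.2 h3
    · obtain ⟨l, rfl⟩ := Nat.exists_eq_add_of_le hlt.le
      rw [getVert_append_right]
      refine oσ.other l (by omega) (by omega)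
        (fun h5 => h3 ((isColliderNode_append_right ρ σ (by omega)).2 h5)) ?_
      rintro ⟨s, t, h5, h6, h7⟩
      exact h4 ⟨_, _, (isColliderSection_append_right ρ σ h5.1).2 h5, by omega, by omega⟩
  · rwa [getVert_append_left ρ σ (by omega)]
  · rw [hlen, Nat.add_sub_assoc (by omega), getVert_append_right]
    exact hn'

section Reverse

variable {x y : V} (ρ : G.skeleton.Walk x y)

lemma isColliderNode_reverse {k : ℕ} (hk : k ≤ ρ.length) :
    IsColliderNode ρ.reverse k ↔ IsColliderNode ρ (ρ.length - k) := by
  by_cases h : 0 < k ∧ k < ρ.length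
  · have e1 : ρ.length - (k - 1) = ρ.length - k + 1 := by omega
    have e2 : ρ.length - (k + 1) = ρ.length - k - 1 := by omega
    rw [IsColliderNode, IsColliderNode, SimpleGraph.Walk.getVert_reverse,
      SimpleGraph.Walk.getVert_reverse, SimpleGraph.Walk.getVert_reverse, e1, e2,
      SimpleGraph.Walk.length_reverse, or_comm]
    exact and_congr (by omega) (and_congr_left fun _ => by omega)
  · refine iff_of_false (fun h' => h ⟨h'.1, ?_⟩) (fun h' => h ⟨?_, ?_⟩)
    · simpa using h'.2.1
    · have := h'.2.1
      omega
    · have := h'.1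
      omega

lemma IsColliderSection.reverse {ρ : G.skeleton.Walk x y} {s t : ℕ} (h : IsColliderSection ρ s t) :
    IsColliderSection ρ.reverse (ρ.length - t) (ρ.length - s) := by
  obtain ⟨h1, h2, h3, h4, h5, h6⟩ := h
  have e1 : ρ.length - (ρ.length - t - 1) = t + 1 := by omega
  have e2 : ρ.length - (ρ.length - s + 1) = s - 1 := by omega
  refine ⟨by omega, by omega, by rw [SimpleGraph.Walk.length_reverse]; omega, ?_,
    fun k h7 h8 => ?_, ?_⟩
  · rwa [SimpleGraph.Walk.getVert_reverse, SimpleGraph.Walk.getVert_reverse, e1,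
      Nat.sub_sub_self (by omega)]
  · have := h5 (ρ.length - (k + 1)) (by omega) (by omega)
    rw [SimpleGraph.Walk.getVert_reverse, SimpleGraph.Walk.getVert_reverse]
    rw [(by omega : ρ.length - (k + 1) + 1 = ρ.length - k)] at this
    exact G.line_symm _ _ this
  · rwa [SimpleGraph.Walk.getVert_reverse, SimpleGraph.Walk.getVert_reverse, e2,
      Nat.sub_sub_self (by omega)]

lemma PreOpen.reverse {ρ : G.skeleton.Walk x y} (h : PreOpen Z ρ) : PreOpen Z ρ.reverse := by
  refine ⟨fun k hk => ?_, fun s t hst => ?_, fun k h0 hk h3 h4 => ?_⟩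
  · have hk' : k < ρ.length := by simpa using hk.2.1
    rw [SimpleGraph.Walk.getVert_reverse]
    exact h.collider_node _ ((isColliderNode_reverse ρ hk'.le).1 hk)
  · have h1 := hst.reverse
    rw [SimpleGraph.Walk.reverse_reverse, SimpleGraph.Walk.length_reverse] at h1
    have h2 := hst.2.2.1
    have h3 := hst.2.1
    rw [SimpleGraph.Walk.length_reverse] at h2
    obtain ⟨k, h4, h5, h6⟩ := h.collider_section _ _ h1
    refine ⟨ρ.length - k, by omega, by omega, ?_⟩
    rwa [SimpleGraph.Walk.getVert_reverse, Nat.sub_sub_self (by omega)]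
  · rw [SimpleGraph.Walk.length_reverse] at hk
    rw [SimpleGraph.Walk.getVert_reverse]
    refine h.other _ (by omega) (by omega)
      (fun h5 => h3 ((isColliderNode_reverse ρ hk.le).2 h5)) ?_
    rintro ⟨s, t, h5, h6, h7⟩
    exact h4 ⟨_, _, h5.reverse, by omega, by omega⟩

lemma OpenVia.symm {m n : Mark} (h : G.OpenVia Z m x y n) : G.OpenVia Z n y x m := by
  obtain ⟨ρ, h0, h1, h2, h3⟩ := h
  refine ⟨ρ.reverse, by simpa using h0, h1.reverse, ?_, ?_⟩
  · rwa [SimpleGraph.Walk.getVert_reverse]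
  · rwa [SimpleGraph.Walk.getVert_reverse, SimpleGraph.Walk.length_reverse,
      Nat.sub_sub_self (by omega)]

end Reverse

end MixedGraph

/-! ### Elementary open routes -/

namespace MixedGraph

variable {V : Type*} {G : MixedGraph V} {Z : Set V}

/-- `x` and `y` are joined by an undirected route all of whose nodes but possibly the first one are
outside `Z`. -/
def LinkedOff (G : MixedGraph V) (Z : Set V) (x y : V) : Prop :=
  Relation.ReflTransGen (fun u v => G.line u v ∧ v ∉ Z) x y

lemma LinkedOff.linked {x y : V} (h : G.LinkedOff Z x y) : G.Linked x y :=
  Relation.ReflTransGen.mono (fun _ _ h => h.1) _ _ h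

lemma LinkedOff.notMem {x y : V} (h : G.LinkedOff Z x y) (hx : x ∉ Z) : y ∉ Z := by
  cases h with
  | refl => exact hx
  | tail _ h => exact h.2

lemma Linked.linkedOff {x y : V} (h : G.Linked x y) (hZ : ∀ z ∈ Z, ¬ G.Linked x z) :
    G.LinkedOff Z x y := by
  induction h with
  | refl => exact .refl
  | tail h1 h2 ih => exact ih.tail ⟨h2, fun h3 => hZ _ h3 (Relation.ReflTransGen.tail h1 h2)⟩

lemma skeleton_adj_of_line {x y : V} (h : G.line x y) : G.skeleton.Adj x y := Or.inl (Or.inr h)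

lemma skeleton_adj_of_arrow {x y : V} (h : G.Arrow x y) : G.skeleton.Adj x y := Or.inl (Or.inl h)

lemma preOpen_of_forall_not_back {x y : V} {ρ : G.skeleton.Walk x y}
    (h1 : ∀ k < ρ.length, G.line (ρ.getVert k) (ρ.getVert (k + 1)) ∨
      G.solid (ρ.getVert k) (ρ.getVert (k + 1)))
    (h2 : ∀ k, 0 < k → k < ρ.length → ρ.getVert k ∉ Z) : PreOpen Z ρ := by
  refine ⟨fun k hk => ?_, fun s t hst => ?_, fun k h0 hk _ _ => h2 k h0 hk⟩
  · obtain ⟨h0, hk, h3⟩ := hk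
    have h4 := h1 (k - 1) (by omega)
    rw [Nat.sub_add_cancel h0] at h4
    have h5 := h1 k hk
    rcases h3 with ⟨h3, -⟩ | ⟨h3, -⟩
    · rcases h4 with h4 | h4
      · exact absurd ⟨h4, h3⟩ (G.not_line_dashed _ _)
      · exact absurd ⟨h4, h3⟩ (G.not_solid_dashed _ _)
    · rcases h5 with h5 | h5
      · exact absurd ⟨G.line_symm _ _ h5, h3⟩ (G.not_line_dashed _ _)
      · exact absurd ⟨h5, h3⟩ (G.not_solid_dashed_rev _ _)
  · obtain ⟨h0, hst, ht, -, -, h3⟩ := hst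
    rcases h1 t ht with h4 | h4
    · exact absurd ⟨G.line_symm _ _ h4, h3⟩ (G.not_line_solid _ _)
    · exact absurd ⟨h4, h3⟩ (G.not_solid_solid _ _)

lemma exists_walk_of_linkedOff {x y z : V} (h : G.LinkedOff Z x y) (h' : G.line y z) :
    ∃ ρ : G.skeleton.Walk x z, 0 < ρ.length ∧
      (∀ k < ρ.length, G.line (ρ.getVert k) (ρ.getVert (k + 1))) ∧
      ∀ k, 0 < k → k < ρ.length → ρ.getVert k ∉ Z := by
  induction h using Relation.ReflTransGen.head_induction_on with
  | refl =>
    refine ⟨.cons (skeleton_adj_of_line h') .nil, by simp, fun k hk => ?_, fun k h1 h2 => ?_⟩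
    · obtain rfl : k = 0 := by simpa using hk
      simpa using h'
    · simp only [SimpleGraph.Walk.length_cons, SimpleGraph.Walk.length_nil] at h2
      omega
  | head h1 _ ih =>
    obtain ⟨ρ, h2, h3, h4⟩ := ih
    refine ⟨.cons (skeleton_adj_of_line h1.1) ρ, by simp, fun k hk => ?_, fun k h5 h6 => ?_⟩
    · rw [SimpleGraph.Walk.length_cons] at hk
      rcases k with - | k
      · simpa using h1.1
      · simpa using h3 k (by omega)
    · rw [SimpleGraph.Walk.length_cons] at h6
      obtain ⟨k, rfl⟩ := Nat.exists_eq_succ_of_ne_zero h5.ne'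
      rw [Nat.succ_eq_add_one, SimpleGraph.Walk.getVert_cons_succ]
      rcases Nat.eq_zero_or_pos k with rfl | hk
      · simpa using h1.2
      · exact h4 k hk (by omega)

lemma exists_walk_of_linked {x y : V} (h : G.Linked x y) : ∃ ρ : G.skeleton.Walk x y,
    ∀ k < ρ.length, G.line (ρ.getVert k) (ρ.getVert (k + 1)) := by
  induction h using Relation.ReflTransGen.head_induction_on with
  | refl => exact ⟨.nil, by simp⟩
  | head h1 _ ih =>
    obtain ⟨ρ, h3⟩ := ih
    refine ⟨.cons (skeleton_adj_of_line h1) ρ, fun k hk => ?_⟩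
    rw [SimpleGraph.Walk.length_cons] at hk
    rcases k with - | k
    · simpa using h1
    · simpa using h3 k (by omega)

lemma OpenVia.of_edge {x y : V} (hxy : G.skeleton.Adj x y) {m n : Mark} (hm : m.At G y x)
    (hn : n.At G x y) : G.OpenVia Z m x y n := by
  refine ⟨.cons hxy .nil, by simp, ⟨fun k hk => ?_, fun s t hst => ?_, fun k h1 h2 => ?_⟩,
    by simpa using hm, by simpa using hn⟩
  · have := hk.1
    have := hk.2.1
    simp only [SimpleGraph.Walk.length_cons, SimpleGraph.Walk.length_nil] at this
    omega
  · obtain ⟨h1, h2, h3, -⟩ := hst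
    simp only [SimpleGraph.Walk.length_cons, SimpleGraph.Walk.length_nil] at h3
    omega
  · simp only [SimpleGraph.Walk.length_cons, SimpleGraph.Walk.length_nil] at h2
    omega

lemma OpenVia.of_solid {x y : V} (h : G.solid x y) : G.OpenVia Z .tail x y .solid :=
  .of_edge (skeleton_adj_of_arrow (Or.inl h)) (Or.inl h) h

lemma OpenVia.of_dashed {x y : V} (h : G.dashed x y) : G.OpenVia Z .tail x y .dashed :=
  .of_edge (skeleton_adj_of_arrow (Or.inr h)) (Or.inr h) h

lemma OpenVia.of_linkedOff {x y z : V} (h : G.LinkedOff Z x y) (h' : G.line y z) :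
    G.OpenVia Z .line x z .line := by
  obtain ⟨ρ, h0, h1, h2⟩ := exists_walk_of_linkedOff h h'
  refine ⟨ρ, h0, preOpen_of_forall_not_back (fun k hk => Or.inl (h1 k hk)) h2, ?_, ?_⟩
  · have := h1 0 h0
    rw [SimpleGraph.Walk.getVert_zero] at this
    exact G.line_symm _ _ this
  · have := h1 (ρ.length - 1) (by omega)
    rwa [Nat.sub_add_cancel h0, SimpleGraph.Walk.getVert_length] at this

lemma OpenVia.of_solid_linkedOff {f x y z : V} (hf : G.solid f x) (hx : x ∉ Z)
    (h : G.LinkedOff Z x y) (h' : G.line y z) : G.OpenVia Z .tail f z .line := by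
  obtain ⟨ρ, h0, h1, h2⟩ := exists_walk_of_linkedOff h h'
  refine ⟨.cons (skeleton_adj_of_arrow (Or.inl hf)) ρ, by simp,
    preOpen_of_forall_not_back (fun k hk => ?_) (fun k h3 h4 => ?_), ?_, ?_⟩
  · rw [SimpleGraph.Walk.length_cons] at hk
    rcases k with - | k
    · right
      simpa using hf
    · left
      simpa using h1 k (by omega)
  · rw [SimpleGraph.Walk.length_cons] at h4
    obtain ⟨k, rfl⟩ := Nat.exists_eq_succ_of_ne_zero h3.ne'
    rw [Nat.succ_eq_add_one, SimpleGraph.Walk.getVert_cons_succ]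
    rcases Nat.eq_zero_or_pos k with rfl | hk
    · simpa using hx
    · exact h2 k hk (by omega)
  · rw [SimpleGraph.Walk.getVert_cons_succ, SimpleGraph.Walk.getVert_zero]
    exact Or.inl hf
  · have := h1 (ρ.length - 1) (by omega)
    rw [Nat.sub_add_cancel h0, SimpleGraph.Walk.getVert_length] at this
    rw [SimpleGraph.Walk.length_cons, Nat.add_sub_cancel]
    obtain ⟨l, hl⟩ := Nat.exists_eq_succ_of_ne_zero h0.ne'
    rw [hl, Nat.succ_eq_add_one, SimpleGraph.Walk.getVert_cons_succ]
    rwa [hl] at this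

/-- The undirected part is a single collider section, so one visit to `z` opens it wherever its
other nodes lie. With `f = f'` this is a way to turn around. -/
lemma OpenVia.of_solid_solid {f f' x y z : V} (hf : G.solid f x) (hf' : G.solid f' y)
    (hz : z ∈ Z) (hxz : G.Linked x z) (hzy : G.Linked z y) : G.OpenVia Z .tail f f' .tail := by
  obtain ⟨ρ₁, h1⟩ := exists_walk_of_linked hxz
  obtain ⟨ρ₂, h2⟩ := exists_walk_of_linked hzy
  have hρ : ∀ k < (ρ₁.append ρ₂).length,
      G.line ((ρ₁.append ρ₂).getVert k) ((ρ₁.append ρ₂).getVert (k + 1)) := by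
    intro k hk
    rw [SimpleGraph.Walk.length_append] at hk
    by_cases hk' : k < ρ₁.length
    · rw [getVert_append_left _ _ hk'.le, getVert_append_left _ _ hk']
      exact h1 k hk'
    · obtain ⟨l, rfl⟩ := Nat.exists_eq_add_of_le (not_lt.1 hk')
      rw [add_assoc, getVert_append_right, getVert_append_right]
      exact h2 l (by omega)
  have hρz : ∃ k ≤ (ρ₁.append ρ₂).length, (ρ₁.append ρ₂).getVert k ∈ Z := by
    refine ⟨ρ₁.length, by rw [SimpleGraph.Walk.length_append]; omega, ?_⟩
    rwa [getVert_append_left _ _ le_rfl, SimpleGraph.Walk.getVert_length]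
  generalize ρ₁.append ρ₂ = ρ at hρ hρz
  let σ : G.skeleton.Walk f f' := (SimpleGraph.Walk.cons (skeleton_adj_of_arrow (Or.inl hf))
    SimpleGraph.Walk.nil).append (ρ.append
    (SimpleGraph.Walk.cons (G.skeleton.symm.symm _ _ (skeleton_adj_of_arrow (Or.inl hf')))
      SimpleGraph.Walk.nil))
  have hlen : σ.length = ρ.length + 2 := by
    simp [σ]
  have hv0 : σ.getVert 0 = f := by simp
  have hv1 : ∀ k ≤ ρ.length, σ.getVert (k + 1) = ρ.getVert k := by
    intro k hk
    simp only [σ, SimpleGraph.Walk.cons_append, SimpleGraph.Walk.nil_append,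
      SimpleGraph.Walk.getVert_cons_succ]
    rw [getVert_append_left _ _ hk]
  have hv2 : σ.getVert (ρ.length + 2) = f' := by
    rw [← hlen, SimpleGraph.Walk.getVert_length]
  have e0 : G.solid (σ.getVert 0) (σ.getVert 1) := by
    rw [hv0, hv1 0 (Nat.zero_le _), SimpleGraph.Walk.getVert_zero]
    exact hf
  have e1 : ∀ k, 1 ≤ k → k ≤ ρ.length → G.line (σ.getVert k) (σ.getVert (k + 1)) := by
    intro k hk hk'
    obtain ⟨l, rfl⟩ := Nat.exists_eq_add_of_le' hk
    rw [hv1 l (by omega), hv1 (l + 1) hk']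
    exact hρ l (by omega)
  have e2 : G.solid (σ.getVert (ρ.length + 2)) (σ.getVert (ρ.length + 1)) := by
    rw [hv2, hv1 _ le_rfl, SimpleGraph.Walk.getVert_length]
    exact hf'
  have hsec : IsColliderSection σ 1 (ρ.length + 1) :=
    ⟨by omega, by omega, by omega, e0, fun k h1 h2 => e1 k h1 (by omega), e2⟩
  have hmark : ∀ k, 0 < k → k < σ.length → ∃ m n : Mark, m ≠ .dashed ∧ n ≠ .dashed ∧
      m.At G (σ.getVert (k - 1)) (σ.getVert k) ∧ n.At G (σ.getVert (k + 1)) (σ.getVert k) := by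
    intro k hk hk'
    have hm : ∃ m : Mark, m ≠ .dashed ∧ m.At G (σ.getVert (k - 1)) (σ.getVert k) := by
      rcases Nat.eq_or_lt_of_le hk with rfl | hk
      · exact ⟨.solid, by simp, e0⟩
      · have := e1 (k - 1) (by omega) (by omega)
        rw [Nat.sub_add_cancel (by omega)] at this
        exact ⟨.line, by simp, this⟩
    have hn : ∃ n : Mark, n ≠ .dashed ∧ n.At G (σ.getVert (k + 1)) (σ.getVert k) := by
      by_cases h : k = ρ.length + 1
      · subst h
        exact ⟨.solid, by simp, e2⟩
      · exact ⟨.line, by simp, G.line_symm _ _ (e1 k hk (by omega))⟩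
    obtain ⟨m, hm, hm'⟩ := hm
    obtain ⟨n, hn, hn'⟩ := hn
    exact ⟨m, n, hm, hn, hm', hn'⟩
  refine ⟨σ, by omega, ⟨fun k hk => ?_, fun s t hst => ?_, fun k h3 h4 _ h5 => ?_⟩, ?_, ?_⟩
  · obtain ⟨m, n, hm, hn, hm', hn'⟩ := hmark k hk.1 hk.2.1
    rw [isColliderNode_iff_at hk.1 hk.2.1 hm' hn'] at hk
    exact absurd hk.2.2 (by simp [hm, hn])
  · obtain ⟨h3, h4, h5, h6, -, h7⟩ := hst
    have hs : s = 1 := by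
      by_contra hs
      have := e1 (s - 1) (by omega) (by omega)
      rw [Nat.sub_add_cancel (by omega)] at this
      exact G.not_line_solid _ _ ⟨this, h6⟩
    have ht : t = ρ.length + 1 := by
      by_contra ht
      exact G.not_line_solid _ _ ⟨G.line_symm _ _ (e1 t (by omega) (by omega)), h7⟩
    obtain ⟨k, hk, hkz⟩ := hρz
    exact ⟨k + 1, by omega, by omega, by rwa [hv1 k hk]⟩
  · exact absurd ⟨1, ρ.length + 1, hsec, by omega, by omega⟩ h5
  · have := e0
    rw [hv0] at this
    exact Or.inl this
  · have := e2
    rw [hv2] at this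
    rw [hlen]
    exact Or.inl this

end MixedGraph

/-! ### Live nodes and the global Markov property -/

namespace MixedGraph

variable {V : Type*} {G : MixedGraph V} {Z : Set V} {a b : V}

/-- The nodes that are in `Z`, or equal to `a` or `b`, or from which one of these can be reached by
routes of dashed edges and of solid edges followed by undirected edges. -/
inductive Relevant (G : MixedGraph V) (Z : Set V) (a b : V) : V → Prop
  | obs (z : V) : z ∈ Z → Relevant G Z a b z
  | left : Relevant G Z a b a
  | right : Relevant G Z a b b
  | dashed (i j : V) : G.dashed i j → Relevant G Z a b j → Relevant G Z a b i
  | solid (i j k : V) : G.solid i j → G.Linked j k → Relevant G Z a b k → Relevant G Z a b i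

/-- `i` is the end of a `Z`-open route from `a` that is trivial or has a tail at `i`. -/
def TailReach (G : MixedGraph V) (Z : Set V) (a i : V) : Prop :=
  i ∉ Z ∧ (i = a ∨ ∃ m, G.OpenVia Z m a i .tail)

/-- The node `s` can be the first one of an undirected part of an open route from `a`. -/
def Start (G : MixedGraph V) (Z : Set V) (a s : V) : Prop :=
  (s ∉ Z ∧ (G.TailReach Z a s ∨ ∃ f, G.solid f s ∧ G.TailReach Z a f)) ∨
    (s ∈ Z ∧ ∃ m, G.dashed m s ∧ G.TailReach Z a m)

/-- The node `i` can be on an open route from `a`. -/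
def Live (G : MixedGraph V) (Z : Set V) (a i : V) : Prop :=
  ∃ s, G.Start Z a s ∧ G.LinkedOff Z s i

/-- An open route from `a` can be continued by a solid edge into the chain component of `i`. -/
def LiveComp (G : MixedGraph V) (Z : Set V) (a i : V) : Prop :=
  ∃ f s, G.TailReach Z a f ∧ G.solid f s ∧ G.Linked s i

lemma LinkedOff.symm {x y : V} (h : G.LinkedOff Z x y) (hx : x ∉ Z) : G.LinkedOff Z y x := by
  induction h with
  | refl => exact .refl
  | tail h1 h2 ih =>
    exact Relation.ReflTransGen.head ⟨G.line_symm _ _ h2.1, LinkedOff.notMem h1 hx⟩ ih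

lemma OpenVia.of_solid_linkedOff' {f x y : V} (hf : G.solid f x) (hx : x ∉ Z)
    (h : G.LinkedOff Z x y) : ∃ n, G.OpenVia Z .tail f y n := by
  cases h with
  | refl => exact ⟨_, .of_solid hf⟩
  | tail h1 h2 => exact ⟨_, .of_solid_linkedOff hf hx h1 h2.1⟩

lemma TailReach.extend {i j : V} {m n : Mark} (h : G.TailReach Z a i) (h' : G.OpenVia Z m i j n) :
    ∃ m, G.OpenVia Z m a j n := by
  obtain ⟨hi, rfl | ⟨p, hp⟩⟩ := h
  · exact ⟨m, h'⟩
  · exact ⟨p, hp.join h' (Or.inl ⟨hi, Or.inl rfl⟩)⟩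

lemma TailReach.extend_tail {i j : V} {m : Mark} (h : G.TailReach Z a i)
    (h' : G.OpenVia Z m i j .tail) (hj : j ∉ Z) : G.TailReach Z a j :=
  ⟨hj, Or.inr (h.extend h')⟩

/-- Follow arrows downwards from `i`. On meeting `Z`, at a collider node or in a collider section,
turn around and come back along the same edges, which leaves a tail at both ends. Otherwise the
descent arrives at `a` or `b`. -/
lemma Relevant.excursion {i : V} (h : G.Relevant Z a b i) (hi : i ∉ Z) :
    G.OpenVia Z .tail i i .tail ∨ (i = a ∨ ∃ n, G.OpenVia Z .tail i a n) ∨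
      (i = b ∨ ∃ n, G.OpenVia Z .tail i b n) := by
  have key : ∀ {i j : V} {n : Mark}, G.OpenVia Z .tail i j n → j ∉ Z →
      (G.OpenVia Z .tail j j .tail ∨ (j = a ∨ ∃ n, G.OpenVia Z .tail j a n) ∨
        (j = b ∨ ∃ n, G.OpenVia Z .tail j b n)) →
      G.OpenVia Z .tail i i .tail ∨ (i = a ∨ ∃ n, G.OpenVia Z .tail i a n) ∨
        (i = b ∨ ∃ n, G.OpenVia Z .tail i b n) := by
    intro i j n e hj h
    have hok : ∀ {p}, j ∉ Z ∧ (n = .tail ∨ Mark.tail = .tail) ∨ p := Or.inl ⟨hj, Or.inr rfl⟩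
    rcases h with h | (rfl | ⟨m, h⟩) | (rfl | ⟨m, h⟩)
    · exact Or.inl ((e.join h hok).join e.symm (Or.inl ⟨hj, Or.inl rfl⟩))
    · exact Or.inr (Or.inl (Or.inr ⟨n, e⟩))
    · exact Or.inr (Or.inl (Or.inr ⟨m, e.join h hok⟩))
    · exact Or.inr (Or.inr (Or.inr ⟨n, e⟩))
    · exact Or.inr (Or.inr (Or.inr ⟨m, e.join h hok⟩))
  induction h with
  | obs z hz => exact absurd hz hi
  | left => exact Or.inr (Or.inl (Or.inl rfl))
  | right => exact Or.inr (Or.inr (Or.inl rfl))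
  | dashed i j hd _ ih =>
    have e : G.OpenVia Z .tail i j .dashed := .of_dashed hd
    by_cases hj : j ∈ Z
    · exact Or.inl (e.join e.symm (Or.inr ⟨hj, by simp, by simp, Or.inl rfl⟩))
    · exact key e hj (ih hj)
  | solid i j k hs hl _ ih =>
    by_cases hz : ∃ z ∈ Z, G.Linked j z
    · obtain ⟨z, hz, hjz⟩ := hz
      exact Or.inl (.of_solid_solid hs hs hz hjz hjz.symm)
    · push Not at hz
      have hk : k ∉ Z := fun h => hz k h hl
      obtain ⟨n, e⟩ := OpenVia.of_solid_linkedOff' hs (fun h => hz j h (Linked.refl j))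
        (hl.linkedOff hz)
      exact key e hk (ih hk)

/-- No route from `a` to `b` has a `Z`-open interior. -/
def NoOpenVia (G : MixedGraph V) (Z : Set V) (a b : V) : Prop := ∀ m n, ¬ G.OpenVia Z m a b n

/-- Appending an excursion turns any arrival at a relevant node into one with a tail, after which
every edge may follow. An excursion ending at `b` would complete an open route from `a` to `b`. -/
lemma NoOpenVia.tailReach (hsep : G.NoOpenVia Z a b) {i : V} (hi : i ∉ Z)
    (h : i = a ∨ ∃ m n, G.OpenVia Z m a i n) (hr : G.Relevant Z a b i) : G.TailReach Z a i := by
  refine ⟨hi, ?_⟩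
  rcases h with h | ⟨m, n, h⟩
  · exact Or.inl h
  rcases hr.excursion hi with h' | (h' | ⟨p, h'⟩) | (rfl | ⟨p, h'⟩)
  · exact Or.inr ⟨m, h.join h' (Or.inl ⟨hi, Or.inr rfl⟩)⟩
  · exact Or.inl h'
  · exact Or.inr ⟨p, h'.symm⟩
  · exact absurd h (hsep m n)
  · exact absurd (h.join h' (Or.inl ⟨hi, Or.inr rfl⟩)) (hsep m p)

lemma TailReach.live {i : V} (h : G.TailReach Z a i) : G.Live Z a i :=
  ⟨i, Or.inl ⟨h.1, Or.inl h⟩, .refl⟩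

lemma Start.live {i : V} (h : G.Start Z a i) : G.Live Z a i := ⟨i, h, .refl⟩

/-- A start in `Z` is entered by a dashed arrow and left by an undirected edge: it is a collider
node, so its membership in `Z` is what openness requires. -/
lemma Live.openVia_line {i j : V} (h : G.Live Z a i) (hij : G.line i j) :
    ∃ m, G.OpenVia Z m a j .line := by
  obtain ⟨s, ⟨hs, h1 | ⟨f, hf, h1⟩⟩ | ⟨hs, m, hm, h1⟩, h2⟩ := h
  · exact h1.extend (.of_linkedOff h2 hij)
  · exact h1.extend (.of_solid_linkedOff hf hs h2 hij)
  · exact h1.extend ((OpenVia.of_dashed hm).join (.of_linkedOff h2 hij)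
      (Or.inr ⟨hs, by simp, by simp, Or.inl rfl⟩))

lemma Live.reach {i : V} (h : G.Live Z a i) (hi : i ∉ Z) :
    i = a ∨ ∃ m n, G.OpenVia Z m a i n := by
  obtain ⟨s, hs, h⟩ := h
  cases h with
  | refl =>
    rcases hs with ⟨-, h1 | ⟨f, hf, h1⟩⟩ | ⟨hs, -⟩
    · rcases h1.2 with h1 | ⟨m, h1⟩
      · exact Or.inl h1
      · exact Or.inr ⟨m, _, h1⟩
    · obtain ⟨m, h2⟩ := h1.extend (OpenVia.of_solid hf)
      exact Or.inr ⟨m, _, h2⟩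
    · exact absurd hs hi
  | tail h1 h2 =>
    obtain ⟨m, h3⟩ := Live.openVia_line ⟨s, hs, h1⟩ h2.1
    exact Or.inr ⟨m, _, h3⟩

lemma Live.start_of_mem {i : V} (h : G.Live Z a i) (hi : i ∈ Z) :
    ∃ m, G.dashed m i ∧ G.TailReach Z a m := by
  obtain ⟨s, hs, h⟩ := h
  cases h with
  | refl =>
    rcases hs with hs | hs
    · exact absurd hi hs.1
    · exact hs.2
  | tail h1 h2 => exact absurd hi h2.2

/-- If `j ∈ Z` has a mother `m ∉ Z`, then `j` is a collider node between `i` and `m`. The route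
therefore reaches `m` with a tail, and `j` becomes a start by returning from `m`. -/
lemma Live.of_line {i j : V} (h : G.Live Z a i) (hij : G.line i j)
    (hj : ¬ (j ∈ Z ∧ ∀ m, G.dashed m j → m ∈ Z)) : G.Live Z a j := by
  by_cases hjZ : j ∈ Z
  · obtain ⟨m, hm, hmZ⟩ : ∃ m, G.dashed m j ∧ m ∉ Z := by
      by_contra! h'
      exact hj ⟨hjZ, h'⟩
    obtain ⟨n, h1⟩ := h.openVia_line hij
    have h2 := h1.join (OpenVia.of_dashed hm).symm (Or.inr ⟨hjZ, by simp, by simp, Or.inr rfl⟩)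
    exact Start.live (Or.inr ⟨hjZ, m, hm, hmZ, Or.inr ⟨n, h2⟩⟩)
  · obtain ⟨s, hs, h1⟩ := h
    exact ⟨s, hs, h1.tail ⟨hij, hjZ⟩⟩

lemma NoOpenVia.tailReach_of_live (hsep : G.NoOpenVia Z a b) {i : V} (hi : i ∉ Z)
    (h : G.Live Z a i) (hr : G.Relevant Z a b i) : G.TailReach Z a i :=
  hsep.tailReach hi (h.reach hi) hr

lemma NoOpenVia.live_dashed_iff (hsep : G.NoOpenVia Z a b) {m i : V} (hd : G.dashed m i)
    (hm : m ∉ Z) (hi : G.Relevant Z a b i) : G.Live Z a m ↔ G.Live Z a i := by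
  constructor
  · intro h
    have h1 := hsep.tailReach_of_live hm h (.dashed m i hd hi)
    by_cases hiZ : i ∈ Z
    · exact Start.live (Or.inr ⟨hiZ, m, hd, h1⟩)
    · obtain ⟨n, h2⟩ := h1.extend (OpenVia.of_dashed hd)
      exact (hsep.tailReach hiZ (Or.inr ⟨n, _, h2⟩) hi).live
  · intro h
    by_cases hiZ : i ∈ Z
    · obtain ⟨m', hm', h1⟩ := h.start_of_mem hiZ
      exact (h1.extend_tail ((OpenVia.of_dashed hm').join (OpenVia.of_dashed hd).symm
        (Or.inr ⟨hiZ, by simp, by simp, Or.inl rfl⟩)) hm).live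
    · have h1 := hsep.tailReach_of_live hiZ h hi
      exact (h1.extend_tail (OpenVia.of_dashed hd).symm hm).live

/-- If the component meets `Z`, a collider section through `Z` leads from `f'` to `f`. Otherwise
walk freely inside the component to the relevant node `k`, turn the arrival there into a tail, and
walk back and up to `f`. -/
lemma NoOpenVia.tailReach_of_section (hsep : G.NoOpenVia Z a b) {f f' s i k : V}
    (hf' : G.TailReach Z a f') (hs : G.solid f' s) (hsi : G.Linked s i) (hf : G.solid f i)
    (hfZ : f ∉ Z) (hik : G.Linked i k) (hk : G.Relevant Z a b k) : G.TailReach Z a f := by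
  by_cases hz : ∃ z ∈ Z, G.Linked s z
  · obtain ⟨z, hz, hsz⟩ := hz
    exact hf'.extend_tail (.of_solid_solid hs hf hz hsz (hsz.symm.trans hsi)) hfZ
  · push Not at hz
    have hz' : ∀ z ∈ Z, ¬ G.Linked i z := fun z h h' => hz z h (hsi.trans h')
    obtain ⟨n, h1⟩ := OpenVia.of_solid_linkedOff' hs (fun h => hz s h (Linked.refl s))
      ((hsi.trans hik).linkedOff hz)
    obtain ⟨m, h2⟩ := hf'.extend h1
    have h3 := hsep.tailReach (fun h => hz' k h hik) (Or.inr ⟨m, n, h2⟩) hk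
    obtain ⟨n', h4⟩ := OpenVia.of_solid_linkedOff' hf (fun h => hz' i h (Linked.refl i))
      (hik.linkedOff hz')
    exact h3.extend_tail h4.symm hfZ

lemma NoOpenVia.tailReach_of_live_solid (hsep : G.NoOpenVia Z a b) {f i k : V}
    (h : G.Live Z a i) (hf : G.solid f i) (hfZ : f ∉ Z) (hik : G.Linked i k)
    (hk : G.Relevant Z a b k) : G.TailReach Z a f := by
  by_cases hi : i ∈ Z
  · obtain ⟨m, hm, h1⟩ := h.start_of_mem hi
    exact h1.extend_tail ((OpenVia.of_dashed hm).join (OpenVia.of_solid hf).symm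
      (Or.inr ⟨hi, by simp, by simp, Or.inl rfl⟩)) hfZ
  obtain ⟨s, ⟨hs, h1 | ⟨f', hf', h1⟩⟩ | ⟨hs, m, hm, h1⟩, h2⟩ := h
  · obtain ⟨n, h3⟩ := OpenVia.of_solid_linkedOff' hf hi (h2.symm hs)
    exact h1.extend_tail h3.symm hfZ
  · exact hsep.tailReach_of_section h1 hf' h2.linked hf hfZ hik hk
  · rcases Relation.ReflTransGen.cases_head h2 with rfl | ⟨s', ⟨h3, hs'⟩, h4⟩
    · exact absurd hs hi
    · have h5 : G.OpenVia Z .tail f s .line :=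
        .of_solid_linkedOff hf hi (LinkedOff.symm h4 hs') (G.line_symm _ _ h3)
      exact h1.extend_tail ((OpenVia.of_dashed hm).join h5.symm
        (Or.inr ⟨hs, by simp, by simp, Or.inl rfl⟩)) hfZ

lemma NoOpenVia.live_solid_iff (hsep : G.NoOpenVia Z a b) {f i k : V} (hf : G.solid f i)
    (hfZ : f ∉ Z) (hik : G.Linked i k) (hk : G.Relevant Z a b k)
    (hi : ¬ (i ∈ Z ∧ ∀ m, G.dashed m i → m ∈ Z)) : G.Live Z a f ↔ G.Live Z a i := by
  refine ⟨fun h => ?_, fun h => (hsep.tailReach_of_live_solid h hf hfZ hik hk).live⟩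
  have h1 := hsep.tailReach_of_live hfZ h (.solid f i k hf hik hk)
  by_cases hiZ : i ∈ Z
  · obtain ⟨m, hm, hmZ⟩ : ∃ m, G.dashed m i ∧ m ∉ Z := by
      by_contra! h'
      exact hi ⟨hiZ, h'⟩
    have h2 := h1.extend_tail ((OpenVia.of_solid hf).join (OpenVia.of_dashed hm).symm
      (Or.inr ⟨hiZ, by simp, by simp, Or.inr rfl⟩)) hmZ
    exact Start.live (Or.inr ⟨hiZ, m, hm, h2⟩)
  · exact Start.live (Or.inl ⟨hiZ, Or.inr ⟨f, hf, h1⟩⟩)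

lemma NoOpenVia.live_iff_liveComp (hsep : G.NoOpenVia Z a b) {f i k : V} (hf : G.solid f i)
    (hfZ : f ∉ Z) (hik : G.Linked i k) (hk : G.Relevant Z a b k) :
    G.Live Z a f ↔ G.LiveComp Z a i := by
  constructor
  · intro h
    exact ⟨f, i, hsep.tailReach_of_live hfZ h (.solid f i k hf hik hk), hf, Linked.refl i⟩
  · rintro ⟨f', s, h1, h2, h3⟩
    exact (hsep.tailReach_of_section h1 h2 h3 hf hfZ hik hk).live

variable [Fintype V]

/-- The abstract marks are realized by relevance, liveness, and liveness of the component; a live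
`b` would be reached from `a` by an open route. -/
lemma Factorization.mulVec_eq_zero_of_noOpenVia (hG : G.IsChainGraph) {A W B F : Matrix V V ℝ}
    (hf : G.Factorization A W B F) {γ : V → ℝ} (hγ : IsResid A Z a γ) (ha : a ∉ Z) (hb : b ∉ Z)
    (hab : a ≠ b) (hsep : G.NoOpenVia Z a b) : (A *ᵥ γ) b = 0 := by
  refine hf.mulVec_eq_zero hG hγ (R := G.Relevant Z a b) (P := G.Live Z a) (T := G.LiveComp Z a)
    .obs .left .right .dashed .solid (TailReach.live ⟨ha, Or.inl rfl⟩) (fun h => ?_)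
    (fun m i hd hm hi => hsep.live_dashed_iff hd hm hi)
    (fun i j h hi hj => ⟨fun h' => h'.of_line h hj, fun h' => h'.of_line (G.line_symm _ _ h) hi⟩)
    (fun f i h1 h2 ⟨k, h3, h4⟩ h5 => hsep.live_solid_iff h1 h2 h3 h4 h5) (fun i j h => ?_)
    (fun f i h1 h2 ⟨k, h3, h4⟩ => hsep.live_iff_liveComp h1 h2 h3 h4)
  · rcases h.reach hb with h | ⟨m, n, h⟩
    · exact hab h.symm
    · exact hsep m n h
  · have hl := linked_of_line h
    exact ⟨fun ⟨f, s, h1, h2, h3⟩ => ⟨f, s, h1, h2, h3.trans hl⟩,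
      fun ⟨f, s, h1, h2, h3⟩ => ⟨f, s, h1, h2, h3.trans hl.symm⟩⟩

lemma Factorization.globalMarkov (hG : G.IsChainGraph) {p : Measure (V → ℝ)} [IsGaussian p]
    (hp : (covMatrix p).PosDef) {W B F : Matrix V V ℝ}
    (hf : G.Factorization (covMatrix p) W B F) : G.GlobalMarkov p := by
  intro X Y Z hXY hXZ hYZ hsep
  refine condIndepCoords_of_resid hXZ fun a ha => ?_
  have haZ := Set.disjoint_left.1 hXZ ha
  obtain ⟨γ, hγ⟩ := exists_isResid hp haZ
  refine ⟨γ, hγ, fun b hb => ?_⟩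
  have hbZ := Set.disjoint_left.1 hYZ hb
  refine hf.mulVec_eq_zero_of_noOpenVia hG hγ haZ hbZ
    (fun h => Set.disjoint_left.1 hXY ha (h ▸ hb)) ?_
  rintro m n ⟨ρ, -, hρ, -, -⟩
  exact hsep a ha b hb ρ (hρ.isOpenRoute haZ hbZ)

end MixedGraph

/-! ### The separations behind the pairwise property -/

namespace MixedGraph

variable {V : Type*} {G : MixedGraph V} {Z : Set V}

lemma adj_cases {x y : V} (h : G.skeleton.Adj x y) : G.Arrow x y ∨ G.line x y ∨ G.Arrow y x := by
  rcases h with (h | h) | (h | h)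
  · exact Or.inl h
  · exact Or.inr (Or.inl h)
  · exact Or.inr (Or.inr h)
  · exact Or.inr (Or.inl (G.line_symm _ _ h))

lemma exists_mark {x y : V} (h : G.skeleton.Adj x y) : ∃ m : Mark, m.At G x y := by
  rcases adj_cases h with (h | h) | h | h
  · exact ⟨.solid, h⟩
  · exact ⟨.dashed, h⟩
  · exact ⟨.line, h⟩
  · exact ⟨.tail, h⟩

lemma exists_mark_of_arrow {x y : V} (h : G.Arrow x y) :
    ∃ m : Mark, m.At G x y ∧ (m = .solid ∨ m = .dashed) := by
  rcases h with h | h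
  · exact ⟨.solid, h, Or.inl rfl⟩
  · exact ⟨.dashed, h, Or.inr rfl⟩

variable {x y : V} {ρ : G.skeleton.Walk x y}

lemma exists_marks {k : ℕ} (h0 : 0 < k) (hk : k < ρ.length) :
    ∃ m n : Mark, m.At G (ρ.getVert (k - 1)) (ρ.getVert k) ∧
      n.At G (ρ.getVert (k + 1)) (ρ.getVert k) := by
  have h1 := ρ.adj_getVert_succ (i := k - 1) (by omega)
  rw [Nat.sub_add_cancel h0] at h1
  obtain ⟨m, hm⟩ := exists_mark h1
  obtain ⟨n, hn⟩ := exists_mark (ρ.adj_getVert_succ hk).symm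
  exact ⟨m, n, hm, hn⟩

lemma IsOpenRoute.notMem_of_arrow_succ (h : IsOpenRoute Z ρ) {k : ℕ} (hk : k < ρ.length)
    (ha : G.Arrow (ρ.getVert k) (ρ.getVert (k + 1))) : ρ.getVert k ∉ Z := by
  refine h.other k hk.le (fun hc => ?_) ?_
  · obtain ⟨m, n, hm, hn⟩ := exists_marks hc.1 hk
    exact ((isColliderNode_iff_at hc.1 hk hm hn).1 hc).2.1 (hn.tail_eq ha)
  · rintro ⟨s, t, hst, h1, h2⟩
    simpa using hst.at_next (m := .tail) h1 h2 ha

lemma IsOpenRoute.notMem_of_arrow_pred (h : IsOpenRoute Z ρ) {k : ℕ} (hk : k < ρ.length)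
    (ha : G.Arrow (ρ.getVert (k + 1)) (ρ.getVert k)) : ρ.getVert (k + 1) ∉ Z := by
  refine h.other (k + 1) hk (fun hc => ?_) ?_
  · obtain ⟨m, n, hm, hn⟩ := exists_marks hc.1 hc.2.1
    exact ((isColliderNode_iff_at hc.1 hc.2.1 hm hn).1 hc).1 (hm.tail_eq ha)
  · rintro ⟨s, t, hst, h1, h2⟩
    simpa using hst.at_prev (m := .tail) h1 h2 ha

/-- Between a forward and a later backward arrow, an open route meets the conditioning set. -/
lemma IsOpenRoute.exists_mem_of_arrows (h : IsOpenRoute Z ρ) {p e : ℕ} (hpe : p < e)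
    (he : e < ρ.length) (h1 : G.Arrow (ρ.getVert p) (ρ.getVert (p + 1)))
    (h2 : G.Arrow (ρ.getVert (e + 1)) (ρ.getVert e)) : ∃ k, p < k ∧ k ≤ e ∧ ρ.getVert k ∈ Z := by
  classical
  induction hn : e - p using Nat.strong_induction_on generalizing p with
  | _ n ih =>
    subst hn
    -- `t` ends the undirected part after the forward arrow. If a forward arrow leaves it, induct
    -- from there. If an arrow points back into it, the part is a collider section or has a collider
    -- node at one of its ends.
    have hex : ∃ t, p < t ∧ ¬ G.line (ρ.getVert t) (ρ.getVert (t + 1)) := by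
      refine ⟨e, hpe, fun hl => ?_⟩
      simpa using Mark.At.tail_eq (m := .line) hl h2
    have hmin : ∀ k, p < k → k < Nat.find hex → G.line (ρ.getVert k) (ρ.getVert (k + 1)) :=
      fun k h3 h4 => not_not.1 fun h5 => Nat.find_min hex h4 ⟨h3, h5⟩
    obtain ⟨hpt, hnl⟩ := Nat.find_spec hex
    have hte : Nat.find hex ≤ e := by
      refine Nat.find_min' hex ⟨hpe, fun hl => ?_⟩
      simpa using Mark.At.tail_eq (m := .line) hl h2
    generalize Nat.find hex = t at hmin hpt hnl hte
    have htl : t < ρ.length := lt_of_le_of_lt hte he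
    rcases adj_cases (ρ.adj_getVert_succ htl) with h3 | h3 | h3
    · have hne : t ≠ e := by
        rintro rfl
        obtain ⟨m, hm, hm'⟩ := exists_mark_of_arrow h3
        rw [hm.tail_eq h2] at hm'
        simp at hm'
      obtain ⟨k, h4, h5, h6⟩ := ih (e - t) (by omega) (by omega) h3 rfl
      exact ⟨k, by omega, h5, h6⟩
    · exact absurd h3 hnl
    · obtain ⟨m, hm, hm'⟩ := exists_mark_of_arrow h1
      obtain ⟨n, hn, hn'⟩ := exists_mark_of_arrow h3
      have hmt : m ≠ .tail := by rcases hm' with rfl | rfl <;> simp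
      have hnt : n ≠ .tail := by rcases hn' with rfl | rfl <;> simp
      by_cases hss : m = .solid ∧ n = .solid
      · obtain ⟨rfl, rfl⟩ := hss
        obtain ⟨k, h4, h5, h6⟩ := h.collider_section (p + 1) t
          ⟨by omega, hpt, htl, hm, fun k h4 h5 => hmin k (by omega) h5, hn⟩
        exact ⟨k, by omega, by omega, h6⟩
      have hd : m = .dashed ∨ n = .dashed := by
        rcases hm' with rfl | rfl
        · exact Or.inr (hn'.resolve_left fun h' => hss ⟨rfl, h'⟩)
        · exact Or.inl rfl
      rcases Nat.eq_or_lt_of_le (Nat.succ_le_of_lt hpt) with rfl | hlt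
      · exact ⟨p + 1, by omega, hte, h.collider_node _
          ((isColliderNode_iff_at (by omega) htl hm hn).2 ⟨hmt, hnt, hd⟩)⟩
      rcases hd with rfl | rfl
      · refine ⟨p + 1, by omega, by omega, h.collider_node _ ?_⟩
        have hl : Mark.line.At G (ρ.getVert (p + 1 + 1)) (ρ.getVert (p + 1)) :=
          G.line_symm _ _ (hmin (p + 1) (by omega) hlt)
        exact (isColliderNode_iff_at (m := .dashed) (by omega) (by omega) hm hl).2 (by simp)
      · refine ⟨t, by omega, hte, h.collider_node _ ?_⟩
        have hl := hmin (t - 1) (by omega) (by omega)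
        rw [Nat.sub_add_cancel (by omega)] at hl
        exact (isColliderNode_iff_at (m := .line) (by omega) htl hl hn).2 (by simp)

lemma steps_of_forall {n k l : ℕ}
    (h : ∀ r < n, Relation.ReflTransGen G.Step (ρ.getVert (r + 1)) (ρ.getVert r)) (hkl : k ≤ l)
    (hl : l ≤ n) : Relation.ReflTransGen G.Step (ρ.getVert l) (ρ.getVert k) := by
  induction l, hkl using Nat.le_induction with
  | base => exact .refl
  | succ l _ ih => exact (h l (by omega)).trans (ih (by omega))

lemma linked_of_forall {k l : ℕ} (hkl : k ≤ l)
    (h : ∀ r, k ≤ r → r < l → G.line (ρ.getVert r) (ρ.getVert (r + 1))) :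
    G.Linked (ρ.getVert k) (ρ.getVert l) := by
  induction l, hkl using Nat.le_induction with
  | base => exact Linked.refl _
  | succ l hkl ih =>
    exact (ih fun r h1 h2 => h r h1 (by omega)).trans (linked_of_line (h l hkl (by omega)))

/-- An open route enters `Pred i` for the first time against an arrow, hence at a node outside the
conditioning set, which must be `j`. The part before avoids that set, so it has no forward arrow,
and acyclicity rules out backward ones: it is undirected. The arrow from `j` into it cannot be
solid, as `j` is no father of the component; if dashed, it points at `i` or creates a collider node
outside the conditioning set. -/
lemma IsChainGraph.separated_Pred (hG : G.IsChainGraph) {i j : V} (hj : j ∈ G.Pred i)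
    (h1 : j ∉ G.Fa (G.comp i)) (h2 : ¬ G.dashed j i) :
    G.Separated {i} {j} (G.Pred i \ {j}) := by
  classical
  rintro a rfl b rfl ρ hρ
  have hex : ∃ q, ρ.getVert q ∈ G.Pred a := ⟨ρ.length, by simpa using hj⟩
  have hmin : ∀ k < Nat.find hex, ρ.getVert k ∉ G.Pred a := fun k hk => Nat.find_min hex hk
  have hq := Nat.find_spec hex
  have hql : Nat.find hex ≤ ρ.length := Nat.find_min' hex (by simpa using hj)
  generalize Nat.find hex = q at hmin hq hql
  have hq0 : q ≠ 0 := by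
    rintro rfl
    rw [SimpleGraph.Walk.getVert_zero] at hq
    exact notMem_Pred_self a hq
  obtain ⟨n, rfl⟩ := Nat.exists_eq_succ_of_ne_zero hq0
  rw [Nat.succ_eq_add_one] at *
  have hn : StrictDesc G a (ρ.getVert n) ∨ G.Linked a (ρ.getVert n) := by
    have := hmin n (by omega)
    rw [mem_Pred] at this
    tauto
  have harr : G.Arrow (ρ.getVert (n + 1)) (ρ.getVert n) := by
    rcases adj_cases (ρ.adj_getVert_succ (by omega : n < ρ.length)) with h | h | h
    · refine absurd ?_ (mem_Pred.1 hq).1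
      rcases hn with hn | hn
      · exact hn.trans_steps (.single (Or.inl h))
      · exact StrictDesc.steps_trans hn.steps (.of_arrow h)
    · exact absurd (mem_Pred_of_linked hq (linked_of_line (G.line_symm _ _ h))) (hmin n (by omega))
    · exact h
  have hqj : ρ.getVert (n + 1) = b := by
    have := hρ.notMem_of_arrow_pred (by omega : n < ρ.length) harr
    by_contra hne
    exact this ⟨hq, hne⟩
  have hZ : ∀ k < n + 1, ρ.getVert k ∉ G.Pred a \ {b} := fun k hk h => hmin k hk h.1
  have hfwd : ∀ r < n, G.line (ρ.getVert r) (ρ.getVert (r + 1)) ∨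
      G.Arrow (ρ.getVert (r + 1)) (ρ.getVert r) := by
    intro r hr
    rcases adj_cases (ρ.adj_getVert_succ (by omega : r < ρ.length)) with h | h | h
    · obtain ⟨k, -, h4, h5⟩ := hρ.exists_mem_of_arrows hr (by omega) h harr
      exact absurd h5 (hZ k (by omega))
    · exact Or.inl h
    · exact Or.inr h
  have hsteps : ∀ r < n, Relation.ReflTransGen G.Step (ρ.getVert (r + 1)) (ρ.getVert r) := by
    intro r hr
    rcases hfwd r hr with h | h
    · exact .single (Or.inr (G.line_symm _ _ h))
    · exact .single (Or.inl h)
  have hline : ∀ r < n, G.line (ρ.getVert r) (ρ.getVert (r + 1)) := by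
    intro r hr
    refine (hfwd r hr).resolve_right fun h => ?_
    have h4 : StrictDesc G (ρ.getVert n) a := by
      have h5 := steps_of_forall hsteps (Nat.zero_le r) hr.le
      rw [SimpleGraph.Walk.getVert_zero] at h5
      exact ⟨_, _, steps_of_forall hsteps hr le_rfl, h, h5⟩
    refine hG.irrefl a ?_
    rcases hn with hn | hn
    · exact hn.trans_steps h4.steps
    · exact StrictDesc.steps_trans hn.steps h4
  have hlink : G.Linked a (ρ.getVert n) := by
    have := linked_of_forall (Nat.zero_le n) fun r _ hr => hline r hr
    rwa [SimpleGraph.Walk.getVert_zero] at this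
  rcases harr with h | h
  · rw [hqj] at h
    exact h1 ⟨_, hlink, h⟩
  · rcases Nat.eq_zero_or_pos n with rfl | hn0
    · rw [hqj, SimpleGraph.Walk.getVert_zero] at h
      exact h2 h
    · have hl := hline (n - 1) (by omega)
      rw [Nat.sub_add_cancel hn0] at hl
      exact hZ n (by omega) (hρ.collider_node n
        ((isColliderNode_iff_at (m := .line) (n := .dashed) hn0 (by omega) hl h).2 (by simp)))

/-- Between the last visit to `i` and the first to `j`, all non-descendants lie in the conditioning
set. If the next node is a non-descendant, the edge to it is undirected; openness there requires a
mother or father of the component on the route, which lies in the conditioning set although it has a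
tail. If the next node is a strict descendant, the route returns against an arrow, and some strict
descendant in between would have to be in the conditioning set. -/
lemma IsChainGraph.separated_Nd (hG : G.IsChainGraph) {i j : V} (hij : j ≠ i)
    (hj : j ∈ G.Nd {i}) (h2 : j ∉ G.Mo (G.comp i)) (hadj : ¬ G.skeleton.Adj i j) :
    G.Separated {i} {j} (G.Nd {i} \ {i, j}) := by
  classical
  rintro a rfl b rfl ρ hρ
  have hex : ∃ q, ρ.getVert q = b := ⟨ρ.length, by simp⟩
  have hmin : ∀ k < Nat.find hex, ρ.getVert k ≠ b := fun k hk => Nat.find_min hex hk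
  have hq := Nat.find_spec hex
  have hql : Nat.find hex ≤ ρ.length := Nat.find_min' hex (by simp)
  generalize Nat.find hex = q at hmin hq hql
  have hmq := Nat.findGreatest_le (P := fun k => ρ.getVert k = a) q
  have hma : ρ.getVert (Nat.findGreatest (fun k => ρ.getVert k = a) q) = a :=
    Nat.findGreatest_spec (P := fun k => ρ.getVert k = a) (Nat.zero_le q) (by simp)
  have hmax : ∀ k, Nat.findGreatest (fun k => ρ.getVert k = a) q < k → k ≤ q → ρ.getVert k ≠ a :=
    fun k h3 h4 => Nat.findGreatest_is_greatest h3 h4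
  generalize Nat.findGreatest (fun k => ρ.getVert k = a) q = m at hmq hma hmax
  have hmq' : m < q := lt_of_le_of_ne hmq fun h => hij (by rw [← hq, ← h, hma])
  have hkq : m + 1 < q := by
    refine lt_of_le_of_ne hmq' fun h => hadj ?_
    have := ρ.adj_getVert_succ (by omega : m < ρ.length)
    rwa [hma, h, hq] at this
  have hZ : ∀ k, m < k → k < q → ρ.getVert k ∈ G.Nd {a} →
      ρ.getVert k ∈ G.Nd {a} \ {a, b} := by
    intro k h3 h4 h5
    refine ⟨h5, ?_⟩
    rintro (h6 | h6)
    · exact hmax k h3 h4.le h6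
    · exact hmin k h4 h6
  have hPred : ∀ x ∈ G.Pred a, x ≠ b → x ∈ G.Nd {a} \ {a, b} := by
    intro x hx hxb
    refine ⟨hx.1, ?_⟩
    rintro (rfl | h6)
    · exact notMem_Pred_self _ hx
    · exact hxb h6
  have hstep := adj_cases (ρ.adj_getVert_succ (by omega : m < ρ.length))
  by_cases hk : ρ.getVert (m + 1) ∈ G.Nd {a}
  · have hkZ := hZ (m + 1) (by omega) hkq hk
    have hl : G.line (ρ.getVert m) (ρ.getVert (m + 1)) := by
      rcases hstep with h | h | h
      · rw [hma] at h
        exact absurd (StrictDesc.of_arrow h) (mem_Nd_singleton.1 hk)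
      · exact h
      · exact absurd hkZ (hρ.notMem_of_arrow_pred (by omega) h)
    have hlink : G.Linked a (ρ.getVert (m + 1)) := by
      have := linked_of_line hl
      rwa [hma] at this
    by_cases hc : IsColliderNode ρ (m + 1)
    · obtain ⟨m', n', hm', hn'⟩ := exists_marks (ρ := ρ) (k := m + 1) (by omega) (by omega)
      obtain ⟨-, h4, h5⟩ := (isColliderNode_iff_at (by omega) (by omega) hm' hn').1 hc
      obtain rfl := hm'.line_eq hl
      obtain rfl : n' = .dashed := by simpa using h5
      have hmo : ρ.getVert (m + 1 + 1) ∈ G.Mo (G.comp a) := ⟨_, hlink, hn'⟩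
      refine hρ.notMem_of_arrow_pred (by omega : m + 1 < ρ.length) (Or.inr hn') ?_
      exact hPred _ (hG.Mo_comp_subset a hmo) fun h => h2 (h ▸ hmo)
    · have hs : ∃ s t, IsColliderSection ρ s t ∧ s ≤ m + 1 ∧ m + 1 ≤ t := by
        by_contra hs
        exact hρ.other (m + 1) (by omega) hc hs hkZ
      obtain ⟨s, t, ⟨hs0, -, htl, hsol, hline, -⟩, hsm, hmt⟩ := hs
      -- The edge from `a` to this node is undirected, so the section extends back through `a`, and
      -- the node before it is a father of the component.
      have hsm' : s ≤ m := by
        by_contra hcon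
        obtain rfl : s = m + 1 := by omega
        exact G.not_line_solid _ _ ⟨hl, hsol⟩
      have hlink' : G.Linked a (ρ.getVert s) := by
        have := linked_of_forall hsm' fun r h3 h4 => hline r h3 (by omega)
        rw [hma] at this
        exact this.symm
      have hfa : ρ.getVert (s - 1) ∈ G.Fa (G.comp a) := ⟨_, hlink', hsol⟩
      refine hρ.notMem_of_arrow_succ (k := s - 1) (by omega) ?_
        (hPred _ (hG.Fa_comp_subset a hfa) (hmin _ (by omega)))
      rw [Nat.sub_add_cancel hs0]
      exact Or.inl hsol
  · have hd : StrictDesc G a (ρ.getVert (m + 1)) := by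
      rwa [mem_Nd_singleton, not_not] at hk
    have harr : G.Arrow (ρ.getVert m) (ρ.getVert (m + 1)) := by
      rcases hstep with h | h | h
      · exact h
      · rw [hma] at h
        exact absurd (hG.comp_subset_Nd a (linked_of_line h)) hk
      · rw [hma] at h
        exact absurd (hd.trans_steps (.single (Or.inl h))) (hG.irrefl a)
    have hex : ∃ e, m + 1 < e ∧ ρ.getVert e ∈ G.Nd {a} := ⟨q, hkq, by rwa [hq]⟩
    have hmine : ∀ k, m + 1 < k → k < Nat.find hex → ρ.getVert k ∉ G.Nd {a} :=
      fun k h3 h4 h5 => Nat.find_min hex h4 ⟨h3, h5⟩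
    obtain ⟨hme, he⟩ := Nat.find_spec hex
    have heq : Nat.find hex ≤ q := Nat.find_min' hex ⟨hkq, by rwa [hq]⟩
    generalize Nat.find hex = e at hmine hme he heq
    obtain ⟨n, rfl⟩ := Nat.exists_eq_succ_of_ne_zero (by omega : e ≠ 0)
    rw [Nat.succ_eq_add_one] at *
    have hbetween : ∀ k, m < k → k ≤ n → ρ.getVert k ∉ G.Nd {a} := by
      intro k h3 h4
      rcases Nat.eq_or_lt_of_le (Nat.succ_le_of_lt h3) with rfl | h5
      · exact hk
      · exact hmine k h5 (by omega)
    have hdn : StrictDesc G a (ρ.getVert n) := by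
      have := hbetween n (by omega) le_rfl
      rwa [mem_Nd_singleton, not_not] at this
    have hnot : ¬ Relation.ReflTransGen G.Step (ρ.getVert n) (ρ.getVert (n + 1)) :=
      fun h => mem_Nd_singleton.1 he (hdn.trans_steps h)
    have hback : G.Arrow (ρ.getVert (n + 1)) (ρ.getVert n) := by
      rcases adj_cases (ρ.adj_getVert_succ (by omega : n < ρ.length)) with h | h | h
      · exact absurd (.single (Or.inl h)) hnot
      · exact absurd (.single (Or.inr h)) hnot
      · exact h
    obtain ⟨k, h3, h4, h5⟩ :=
      hρ.exists_mem_of_arrows (by omega : m < n) (by omega) harr hback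
    exact hbetween k h3 h4 h5.1

lemma IsChainGraph.pairwiseMarkov_of_globalMarkov [Fintype V] (hG : G.IsChainGraph)
    {p : Measure (V → ℝ)} [IsFiniteMeasure p] (hp : G.GlobalMarkov p) : G.PairwiseMarkov p := by
  rw [PairwiseMarkov, forall_mem_Cc (P := fun K i => ∀ j, ¬ G.skeleton.Adj i j →
    (j ∈ ((G.Nd {i} \ K) \ G.Fa K) \ G.Mo {i} →
      CondIndepCoords p {i} {j} ((G.Nd {i} \ K) \ {j})) ∧
    (j ∈ ((G.Nd {i} \ {i}) \ G.Fa {i}) \ G.Mo K →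
      CondIndepCoords p {i} {j} (G.Nd {i} \ {i, j})))]
  intro i j hadj
  constructor
  · rintro ⟨⟨hj, h1⟩, h2⟩
    rw [Mo_singleton] at h2
    have hij : j ≠ i := by
      rintro rfl
      exact notMem_Pred_self j hj
    refine hp _ _ _ (by simpa using hij.symm) ?_ (by simp) (hG.separated_Pred hj h1 h2)
    exact Set.disjoint_singleton_left.2 fun h => notMem_Pred_self i h.1
  · rintro ⟨⟨⟨hj, hij⟩, -⟩, h2⟩
    have hij : j ≠ i := hij
    exact hp _ _ _ (by simpa using hij.symm) (by simp) (by simp)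
      (hG.separated_Nd hij hj h2 hadj)

end MixedGraph

theorem mainTheorem1 {V : Type*} [Fintype V] (G : MixedGraph V) (hG : G.IsUCG)
    (p : Measure (V → ℝ)) [IsGaussian p] (hp : (covMatrix p).PosDef) :
    List.TFAE [G.GlobalMarkov p, G.BlockRecursiveMarkov p, G.LocalMarkov p,
      G.PairwiseMarkov p] := by
  have hc := hG.isChainGraph
  obtain ⟨g, h, hr⟩ := MixedGraph.exists_isRegression G hp
  tfae_have 1 → 4 := hc.pairwiseMarkov_of_globalMarkov
  tfae_have 4 ↔ 2 := by
    rw [MixedGraph.pairwiseMarkov_iff hc hp hr, MixedGraph.blockRecursiveMarkov_iff hc hp hr]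
  tfae_have 3 ↔ 2 := by
    rw [MixedGraph.localMarkov_iff hG hp hr, MixedGraph.blockRecursiveMarkov_iff hc hp hr]
  tfae_have 2 → 1 := by
    intro h2
    obtain ⟨W, B, F, hf⟩ := MixedGraph.exists_factorization hG hp hr
      ((MixedGraph.blockRecursiveMarkov_iff hc hp hr).1 h2)
    exact hf.globalMarkov hc hp
  tfae_finish
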